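/- **Online generalized knapsack problem.** A static instance $I$ consists of $n\ge 0$ items with rational weights $w_1,\dots,w_n\ge 0$, a rational penalty rate $c\ge 0$ and a rational bound $P\ge 0$ on the profits. A state $y=(p,B)$ consists of rational profits $p_1,\dots,p_n\in[0,P]$ and a rational capacity $B\ge 0$. The payoff of a set of items $A\subseteq[n]$ in state $y=(p,B)$ is $$f(A,y)=\sum_{i\in A}p_i-c\,\max\Big\{0,\sum_{i\in A}w_i-B\Big\},$$ so the capacity may be exceeded at a linear penalty. In each round $t=1,2,\dots$ a randomized algorithm, which knows $I$ and $y^1,\dots,y^{t-1}$ but neither $y^t$ nor the number of rounds, chooses $x^t\subseteq[n]$; then the state $y^t$ is revealed and the payoff $f(x^t,y^t)$ is gained. The regret after $T$ rounds is $R_T=\max_{x\subseteq[n]}\sum_{t=1}^T f(x,y^t)-\sum_{t=1}^T f(x^t,y^t)$. The states are chosen by an adversary; $y^t$ may depend on $x^1,\dots,x^{t-1}$ and $y^1,\dots,y^{t-1}$, but not on $x^t$ (sequences of states fixed in advance are a special case). Let $G=\max_{x,x',y,y'}|f(x,y)-f(x',y')|=nP+c\sum_{i=1}^n w_i$ be the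 diameter of the payoff function. **Theorem.** There is a polynomial-time vanishing-regret algorithm for the online generalized knapsack problem. That is, there are a randomized online algorithm (one algorithm for all instances), a polynomial $p$ and a constant $0\le\gamma<1$ such that 1. the choice $x^t$ is computed from $I$, $y^1,\dots,y^{t-1}$ and polynomially many fresh fair coin tosses by a fixed random access machine program (with memory cells holding rationals, every operation being charged the bit lengths of its operands and result) in time polynomial in the total bit length of $I,y^1,\dots,y^{t-1}$; in particular, in time polynomial in $t$ and in $s$ whenever $I$ and each single state have at most $s$ bits; 2. for every instance $I$, every adversary and every $T\ge 0$, $\ \mathbb E[R_T]\le p(n)\cdot G\cdot T^{\gamma}$. -/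

import Mathlib

open scoped BigOperators

namespace GKP

/-! ## The generalized knapsack problem and its online version -/

/-- The static part of an online generalized knapsack problem: the number of items, their weights,
the penalty rate `c` and an upper bound `P` on the profits that may occur. -/
structure Inst where
  n : ℕ
  w : Fin n → ℚ
  w_nonneg : ∀ i, 0 ≤ w i
  c : ℚ
  c_nonneg : 0 ≤ c
  P : ℚ
  P_nonneg : 0 ≤ P

/-- The state revealed in one round: profits in `[0, P]` and a capacity `B ≥ 0`. -/
@[ext]
structure State (I : Inst) where
  profit : Fin I.n → ℚ
  profit_nonneg : ∀ i, 0 ≤ profit i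
  profit_le : ∀ i, profit i ≤ I.P
  B : ℚ
  B_nonneg : 0 ≤ B

/-- The payoff of the item set `x` in state `y`:
total profit minus `c` times the excess weight. -/
def payoff (I : Inst) (x : Finset (Fin I.n)) (y : State I) : ℚ :=
  ∑ i ∈ x, y.profit i - I.c * max 0 (∑ i ∈ x, I.w i - y.B)

/-- The diameter of the payoff function, in closed form; `isGreatest_payoffRange` shows that it is
`max |f(x, y) - f(x', y')|` over all item sets `x, x'` and all states `y, y'`. -/
def payoffRange (I : Inst) : ℚ := I.n * I.P + I.c * ∑ i, I.w i

theorem isGreatest_payoffRange (I : Inst) :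
    IsGreatest {d : ℚ | ∃ (x x' : Finset (Fin I.n)) (y y' : State I),
      d = |payoff I x y - payoff I x' y'|} (payoffRange I) := by
  have hW : 0 ≤ ∑ i, I.w i := Finset.sum_nonneg fun i _ => I.w_nonneg i
  have hcW : 0 ≤ I.c * ∑ i, I.w i := mul_nonneg I.c_nonneg hW
  have hnP : 0 ≤ (I.n : ℚ) * I.P := mul_nonneg (Nat.cast_nonneg _) I.P_nonneg
  have hup : ∀ x (y : State I), payoff I x y ≤ I.n * I.P := by
    intro x y
    have h1 : ∑ i ∈ x, y.profit i ≤ I.n * I.P := by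
      calc ∑ i ∈ x, y.profit i ≤ ∑ i, y.profit i :=
            Finset.sum_le_sum_of_subset_of_nonneg (Finset.subset_univ x)
              fun i _ _ => y.profit_nonneg i
        _ ≤ ∑ _i : Fin I.n, I.P := Finset.sum_le_sum fun i _ => y.profit_le i
        _ = I.n * I.P := by simp
    have h2 : 0 ≤ I.c * max 0 (∑ i ∈ x, I.w i - y.B) :=
      mul_nonneg I.c_nonneg (le_max_left _ _)
    unfold payoff
    linarith
  have hlo : ∀ x (y : State I), -(I.c * ∑ i, I.w i) ≤ payoff I x y := by
    intro x y
    have h1 : 0 ≤ ∑ i ∈ x, y.profit i := Finset.sum_nonneg fun i _ => y.profit_nonneg i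
    have h3 : ∑ i ∈ x, I.w i ≤ ∑ i, I.w i :=
      Finset.sum_le_sum_of_subset_of_nonneg (Finset.subset_univ x) fun i _ _ => I.w_nonneg i
    have h2 : I.c * max 0 (∑ i ∈ x, I.w i - y.B) ≤ I.c * ∑ i, I.w i :=
      mul_le_mul_of_nonneg_left (max_le hW (by linarith [y.B_nonneg])) I.c_nonneg
    unfold payoff
    linarith
  refine ⟨⟨Finset.univ, Finset.univ,
    ⟨fun _ => I.P, fun _ => I.P_nonneg, fun _ => le_rfl, ∑ i, I.w i, hW⟩,
    ⟨fun _ => 0, fun _ => le_rfl, fun _ => I.P_nonneg, 0, le_rfl⟩, ?_⟩, ?_⟩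
  · have e : ∀ y y' : State I, y.profit = (fun _ => I.P) → y.B = ∑ i, I.w i →
        y'.profit = (fun _ => 0) → y'.B = 0 →
        payoffRange I = |payoff I Finset.univ y - payoff I Finset.univ y'| := by
      intro y y' h1 h2 h3 h4
      simp only [payoff, h1, h2, h3, h4, payoffRange, sub_self, max_self, sub_zero,
        max_eq_right hW, Finset.sum_const, Finset.card_univ, Fintype.card_fin, nsmul_eq_mul,
        mul_zero, zero_sub, sub_neg_eq_add]
      rw [abs_of_nonneg (add_nonneg hnP hcW)]
    exact e _ _ rfl rfl rfl rfl
  · rintro d ⟨x, x', y, y', rfl⟩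
    rw [abs_le]
    have := hup x y
    have := hup x' y'
    have := hlo x y
    have := hlo x' y'
    unfold payoffRange
    constructor <;> linarith

/-- The regret of a play, given as the list of rounds (chosen item set, revealed state):
the total payoff of the best fixed item set in hindsight minus the total payoff obtained. -/
def regret (I : Inst) (h : List (Finset (Fin I.n) × State I)) : ℚ :=
  Finset.univ.sup' Finset.univ_nonempty
      (fun x : Finset (Fin I.n) => (h.map fun r => payoff I x r.2).sum)
    - (h.map fun r => payoff I r.1 r.2).sum

/-! ## Bit lengths -/

/-- The bit length of a rational number in lowest terms (sign, numerator, denominator). -/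
def ratSize (q : ℚ) : ℕ := q.num.natAbs.size + q.den.size + 1

/-- The bit length of the static part of the problem. -/
def Inst.size (I : Inst) : ℕ := ∑ i, ratSize (I.w i) + ratSize I.c + ratSize I.P

/-- The bit length of a state. -/
def State.size {I : Inst} (y : State I) : ℕ := ∑ i, ratSize (y.profit i) + ratSize y.B

/-- The bit length of everything known before a round: the static part and the past states.
If the static part and every single state have at most `s` bits, then after `t` rounds this is
at most `s * (t + 1)`; it is always at least `n` and at least `t`. -/
def inputSize (I : Inst) (h : List (State I)) : ℕ := I.size + (h.map State.size).sum

/-! ## The machine model: random access machines with logarithmic (bit) cost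

Memory consists of arrays, addressed by natural numbers, whose cells hold rational numbers.
Every operation is charged the bit lengths of its operands and of its result. -/

/-- `σ a i` is the content of cell `i` of array `a`. -/
abbrev Mem := ℕ → ℕ → ℚ

inductive Expr where
  | lit (q : ℚ)
  | read (a : ℕ) (i : Expr)
  | add (e f : Expr)
  | sub (e f : Expr)
  | mul (e f : Expr)
  | div (e f : Expr)
  | floor (e : Expr)
  | le (e f : Expr)

/-- The value of an expression; an index `q` refers to cell `⌊q⌋₊`, a test has value `1` or `0`. -/
def Expr.eval (σ : Mem) : Expr → ℚ
  | .lit q => q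
  | .read a i => σ a ⌊i.eval σ⌋₊
  | .add e f => e.eval σ + f.eval σ
  | .sub e f => e.eval σ - f.eval σ
  | .mul e f => e.eval σ * f.eval σ
  | .div e f => e.eval σ / f.eval σ
  | .floor e => ((⌊e.eval σ⌋ : ℤ) : ℚ)
  | .le e f => if e.eval σ ≤ f.eval σ then 1 else 0

/-- The bit cost of evaluating an expression: the bit lengths of the values of all its
subexpressions (hence also of all addresses used), plus one per operation. -/
def Expr.cost (σ : Mem) : Expr → ℕ
  | .lit q => ratSize q + 1
  | .read a i => i.cost σ + ratSize ((Expr.read a i).eval σ) + 1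
  | .add e f => e.cost σ + f.cost σ + ratSize ((Expr.add e f).eval σ) + 1
  | .sub e f => e.cost σ + f.cost σ + ratSize ((Expr.sub e f).eval σ) + 1
  | .mul e f => e.cost σ + f.cost σ + ratSize ((Expr.mul e f).eval σ) + 1
  | .div e f => e.cost σ + f.cost σ + ratSize ((Expr.div e f).eval σ) + 1
  | .floor e => e.cost σ + ratSize ((Expr.floor e).eval σ) + 1
  | .le e f => e.cost σ + f.cost σ + ratSize ((Expr.le e f).eval σ) + 1

/-- Programs. `store a i e` writes the value of `e` into cell `⌊i⌋₊` of array `a`; a test succeeds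
if its value is nonzero. -/
inductive Prog where
  | skip
  | store (a : ℕ) (i e : Expr)
  | seq (p q : Prog)
  | ite (b : Expr) (p q : Prog)
  | loop (b : Expr) (p : Prog)

/-- `Exec p σ σ' k`: started in memory `σ`, the program `p` halts in memory `σ'` after a
computation of total bit cost `k`. -/
inductive Exec : Prog → Mem → Mem → ℕ → Prop where
  | skip (σ : Mem) : Exec .skip σ σ 1
  | store (σ : Mem) (a : ℕ) (i e : Expr) :
      Exec (.store a i e) σ
        (Function.update σ a (Function.update (σ a) ⌊i.eval σ⌋₊ (e.eval σ)))
        (i.cost σ + e.cost σ + 1)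
  | seq {p q : Prog} {σ σ' σ'' : Mem} {k l : ℕ} (hp : Exec p σ σ' k) (hq : Exec q σ' σ'' l) :
      Exec (.seq p q) σ σ'' (k + l + 1)
  | ite_true {b : Expr} {p q : Prog} {σ σ' : Mem} {k : ℕ} (hb : b.eval σ ≠ 0)
      (hp : Exec p σ σ' k) : Exec (.ite b p q) σ σ' (b.cost σ + k + 1)
  | ite_false {b : Expr} {p q : Prog} {σ σ' : Mem} {k : ℕ} (hb : b.eval σ = 0)
      (hq : Exec q σ σ' k) : Exec (.ite b p q) σ σ' (b.cost σ + k + 1)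
  | loop_stop {b : Expr} {p : Prog} {σ : Mem} (hb : b.eval σ = 0) :
      Exec (.loop b p) σ σ (b.cost σ + 1)
  | loop_step {b : Expr} {p : Prog} {σ σ' σ'' : Mem} {k l : ℕ} (hb : b.eval σ ≠ 0)
      (hp : Exec p σ σ' k) (hl : Exec (.loop b p) σ' σ'' l) :
      Exec (.loop b p) σ σ'' (b.cost σ + k + l + 1)

/-! ## Randomized online algorithms -/

/-- A randomized online algorithm: in each round it tosses fresh fair coins, whose number is
polynomial in the bit length of what it has been given, and chooses an item set from the static
data, the states observed so far and the coins. It is told neither the number of rounds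
nor the current state. -/
structure OnlineAlgorithm where
  coins : Polynomial ℕ
  act : (I : Inst) → (h : List (State I)) →
    (Fin (coins.eval (inputSize I h)) → Bool) → Finset (Fin I.n)

/-- The initial memory. Array `0` holds `n`, the number `t` of past rounds, `c` and `P`; array `1`
the weights; array `2` the past profits, the profit of item `i` in round `τ` in cell `τ * n + i`;
array `3` the past capacities; array `4` the coins. All other cells hold `0`. -/
def initMem (I : Inst) (h : List (State I)) {m : ℕ} (r : Fin m → Bool) : Mem
  | 0, 0 => I.n
  | 0, 1 => h.length
  | 0, 2 => I.c
  | 0, 3 => I.P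
  | 1, j => if hj : j < I.n then I.w ⟨j, hj⟩ else 0
  | 2, j => if hn : 0 < I.n then
      (h[j / I.n]?).elim 0 fun y => y.profit ⟨j % I.n, Nat.mod_lt j hn⟩ else 0
  | 3, j => (h[j]?).elim 0 fun y => y.B
  | 4, j => if hj : j < m then (if r ⟨j, hj⟩ then 1 else 0) else 0
  | _, _ => 0

/-- Every choice of the algorithm is computed by one fixed program, in time polynomial in the bit
length of the static data and the states observed so far. The chosen items are those whose cell in
array `5` holds `1` at the end. -/
def OnlineAlgorithm.PolynomialTime (A : OnlineAlgorithm) : Prop :=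
  ∃ (prog : Prog) (q : Polynomial ℕ), ∀ (I : Inst) (h : List (State I))
    (r : Fin (A.coins.eval (inputSize I h)) → Bool),
    ∃ (σ : Mem) (k : ℕ), Exec prog (initMem I h r) σ k ∧
      k ≤ q.eval (inputSize I h) ∧
      ∀ i : Fin I.n, i ∈ A.act I h r ↔ σ 5 i = 1

/-- The expected regret of a play that has started with the rounds `h` and goes on for `T` more
rounds, against an adversary `adv` that chooses each state from the choices and states of the
earlier rounds: in every round the coins are drawn uniformly, and the algorithm and the adversary
choose simultaneously. -/
def OnlineAlgorithm.expectedRegret (A : OnlineAlgorithm) (I : Inst)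
    (adv : List (Finset (Fin I.n) × State I) → State I) :
    ℕ → List (Finset (Fin I.n) × State I) → ℚ
  | 0, h => regret I h
  | T + 1, h => 𝔼 r : Fin (A.coins.eval (inputSize I (h.map Prod.snd))) → Bool,
      A.expectedRegret I adv T (h ++ [(A.act I (h.map Prod.snd) r, adv h)])

/-- The expected regret after `T` rounds is at most `p(n) * G * T ^ γ` for a polynomial `p` and a
constant `0 ≤ γ < 1`, with `n` the number of items and `G` the diameter of the payoff function,
against every adversary. An adversary who fixes the states `y 0, y 1, …` in advance is the special
case `adv h = y h.length`. -/
def OnlineAlgorithm.VanishingRegret (A : OnlineAlgorithm) : Prop :=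
  ∃ (p : Polynomial ℕ) (γ : ℝ), 0 ≤ γ ∧ γ < 1 ∧
    ∀ (I : Inst) (adv : List (Finset (Fin I.n) × State I) → State I) (T : ℕ),
      (A.expectedRegret I adv T [] : ℝ) ≤ ((p.eval I.n : ℕ) : ℝ) * (payoffRange I : ℝ) * (T : ℝ) ^ γ

end GKP

namespace GKP

/-! ## Random perturbations and the stability of leaders -/

/-- The objective `U` perturbed by profits `G * ξ i`. -/
def perturb {n : ℕ} (U : Finset (Fin n) → ℚ) (G : ℚ) (ξ : Fin n → ℕ) (x : Finset (Fin n)) : ℚ :=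
  U x + G * ∑ i ∈ x, (ξ i : ℚ)

/-- The advantage of the best set containing `i` over the best set avoiding `i`. -/
def gap {n : ℕ} (U : Finset (Fin n) → ℚ) (G : ℚ) (ξ : Fin n → ℕ) (i : Fin n) : ℚ :=
  Finset.univ.sup' Finset.univ_nonempty (fun x : Finset (Fin n) => perturb U G ξ (insert i x)) -
    Finset.univ.sup' Finset.univ_nonempty (fun x : Finset (Fin n) => perturb U G ξ (x.erase i))

theorem sup'_add_const {α : Type*} {s : Finset α} (hs : s.Nonempty) {f g : α → ℚ} {a : ℚ}
    (h : ∀ x ∈ s, f x = g x + a) : s.sup' hs f = s.sup' hs g + a := by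
  apply le_antisymm
  · refine Finset.sup'_le _ _ fun x hx => ?_
    rw [h x hx]
    linarith [Finset.le_sup' g hx]
  · rw [← le_sub_iff_add_le]
    refine Finset.sup'_le _ _ fun x hx => ?_
    have := Finset.le_sup' f hx
    rw [h x hx] at this
    linarith

theorem gap_sub_gap {n : ℕ} (U : Finset (Fin n) → ℚ) (G : ℚ) {ξ ξ' : Fin n → ℕ} {i : Fin n}
    (h : ∀ j, j ≠ i → ξ j = ξ' j) :
    gap U G ξ i = gap U G ξ' i + G * ((ξ i : ℚ) - ξ' i) := by
  have h1 : ∀ x ∈ (Finset.univ : Finset (Finset (Fin n))), perturb U G ξ (insert i x) =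
      perturb U G ξ' (insert i x) + G * ((ξ i : ℚ) - ξ' i) := by
    intro x _
    have e : ∑ j ∈ (insert i x).erase i, (ξ j : ℚ) = ∑ j ∈ (insert i x).erase i, (ξ' j : ℚ) :=
      Finset.sum_congr rfl fun j hj => by rw [h j (Finset.ne_of_mem_erase hj)]
    unfold perturb
    rw [← Finset.add_sum_erase _ _ (Finset.mem_insert_self i x), e,
      ← Finset.add_sum_erase _ (fun j => (ξ' j : ℚ)) (Finset.mem_insert_self i x)]
    ring
  have h2 : ∀ x ∈ (Finset.univ : Finset (Finset (Fin n))), perturb U G ξ (x.erase i) =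
      perturb U G ξ' (x.erase i) + 0 := by
    intro x _
    have e : ∑ j ∈ x.erase i, (ξ j : ℚ) = ∑ j ∈ x.erase i, (ξ' j : ℚ) :=
      Finset.sum_congr rfl fun j hj => by rw [h j (Finset.ne_of_mem_erase hj)]
    unfold perturb
    rw [e, add_zero]
  unfold gap
  rw [sup'_add_const _ h1, sup'_add_const _ h2]
  ring

/-- If no gap is small, then the leader does not change when the objective changes slightly. -/
theorem leader_eq_of_gap {n : ℕ} {U U' : Finset (Fin n) → ℚ} {G d : ℚ} {ξ : Fin n → ℕ}
    (hgap : ∀ i, d < |gap U G ξ i|) (hU : ∀ x x', U' x' - U x' - (U' x - U x) ≤ d)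
    {x x' : Finset (Fin n)} (hx : ∀ z, perturb U G ξ z ≤ perturb U G ξ x)
    (hx' : ∀ z, perturb U' G ξ z ≤ perturb U' G ξ x') : x = x' := by
  have hle : perturb U G ξ x ≤ perturb U G ξ x' + d := by
    have h1 := hx' x
    have h2 := hU x x'
    unfold perturb at *
    linarith
  by_contra hne
  have hi : ∃ i, (i ∈ x ∧ i ∉ x') ∨ (i ∉ x ∧ i ∈ x') := by
    by_contra hcon
    push Not at hcon
    exact hne (Finset.ext fun i => ⟨fun h => by_contra fun h' => h' ((hcon i).1 h),
      fun h => by_contra fun h' => (hcon i).2 h' h⟩)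
  obtain ⟨i, hi⟩ := hi
  have hg := hgap i
  have hup1 : Finset.univ.sup' Finset.univ_nonempty (fun x : Finset (Fin n) => perturb U G ξ (insert i x)) ≤
      perturb U G ξ x := Finset.sup'_le _ _ fun z _ => hx _
  have hup0 : Finset.univ.sup' Finset.univ_nonempty (fun x : Finset (Fin n) => perturb U G ξ (x.erase i)) ≤
      perturb U G ξ x := Finset.sup'_le _ _ fun z _ => hx _
  have hlo1 : ∀ z, i ∈ z → perturb U G ξ z ≤
      Finset.univ.sup' Finset.univ_nonempty (fun x : Finset (Fin n) => perturb U G ξ (insert i x)) := by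
    intro z hz
    have := Finset.le_sup' (fun x : Finset (Fin n) => perturb U G ξ (insert i x)) (Finset.mem_univ z)
    rwa [Finset.insert_eq_of_mem hz] at this
  have hlo0 : ∀ z, i ∉ z → perturb U G ξ z ≤
      Finset.univ.sup' Finset.univ_nonempty (fun x : Finset (Fin n) => perturb U G ξ (x.erase i)) := by
    intro z hz
    have := Finset.le_sup' (fun x : Finset (Fin n) => perturb U G ξ (x.erase i)) (Finset.mem_univ z)
    rwa [Finset.erase_eq_of_notMem hz] at this
  apply absurd hg
  rw [not_lt, abs_le]
  have := hx x'
  unfold gap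
  rcases hi with ⟨h1, h2⟩ | ⟨h1, h2⟩
  · have a1 := hlo1 x h1
    have a2 := hlo0 x' h2
    constructor <;> linarith
  · have a1 := hlo0 x h1
    have a2 := hlo1 x' h2
    constructor <;> linarith

/-- The number with the `J` binary digits `r i, r (n + i), r (2 * n + i), …`. -/
def noise {m : ℕ} (r : Fin m → Bool) (n i : ℕ) : ℕ → ℕ
  | 0 => 0
  | b + 1 => 2 * noise r n i b + if hj : b * n + i < m then (if r ⟨b * n + i, hj⟩ then 1 else 0) else 0

theorem noise_lt {m : ℕ} (r : Fin m → Bool) (n i J : ℕ) : noise r n i J < 2 ^ J := by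
  induction J with
  | zero => simp [noise]
  | succ b ih =>
    rw [noise, pow_succ]
    split_ifs <;> omega

theorem noise_congr {m m' : ℕ} {r : Fin m → Bool} {r' : Fin m' → Bool} {n i J : ℕ}
    (hm : J * n ≤ m) (hm' : J * n ≤ m') (hi : i < n)
    (h : ∀ b < J, ∀ (h1 : b * n + i < m) (h2 : b * n + i < m'), r ⟨_, h1⟩ = r' ⟨_, h2⟩) :
    noise r n i J = noise r' n i J := by
  induction J with
  | zero => rfl
  | succ b ih =>
    have e : (b + 1) * n = b * n + n := by ring
    have h1 : b * n + i < m := by omega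
    have h2 : b * n + i < m' := by omega
    rw [noise, noise, ih (by omega) (by omega) fun b' hb' => h b' (by omega)]
    simp only [h1, h2, dif_pos, h b (Nat.lt_succ_self b) h1 h2]

theorem noise_injective {m : ℕ} {r r' : Fin m → Bool} {n i J : ℕ}
    (h : noise r n i J = noise r' n i J) :
    ∀ b < J, ∀ h1 : b * n + i < m, r ⟨_, h1⟩ = r' ⟨_, h1⟩ := by
  induction J with
  | zero => intro b hb; omega
  | succ J ih =>
    rw [noise, noise] at h
    intro b hb h1
    rcases Nat.lt_succ_iff_lt_or_eq.mp hb with hb | rfl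
    · refine ih ?_ b hb h1
      split_ifs at h <;> omega
    · simp only [h1, dif_pos] at h
      cases hr : r ⟨_, h1⟩ <;> cases hr' : r' ⟨_, h1⟩ <;> simp [hr, hr'] at h ⊢ <;> omega

/-- Every gap is unlikely to be small. -/
theorem card_small_gap_mul_le {n m J : ℕ} (U : Finset (Fin n) → ℚ) {G : ℚ} (hG : 0 < G) (c : ℕ)
    (i : Fin n) (hm : J * n ≤ m) :
    (Finset.univ.filter fun r : Fin m → Bool =>
      |gap U G (fun j => noise r n j J) i| ≤ G * c).card * 2 ^ J ≤ 2 ^ m * (2 * c + 1) := by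
  set S := Finset.univ.filter fun r : Fin m → Bool =>
      |gap U G (fun j => noise r n j J) i| ≤ G * c with hS
  let key : (Fin m → Bool) → ℕ := fun r => ⌊gap U G (fun j => noise r n j J) i / G + c⌋₊
  let flip : (Fin m → Bool) × (Fin J → Bool) → Fin m → Bool := fun p k =>
    if h : k.1 % n = i ∧ k.1 / n < J then p.2 ⟨k.1 / n, h.2⟩ else p.1 k
  have hkey : ∀ r ∈ S, 0 ≤ gap U G (fun j => noise r n j J) i / G + c ∧
      gap U G (fun j => noise r n j J) i / G + c ≤ 2 * c := by
    intro r hr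
    have hr := (Finset.mem_filter.mp hr).2
    rw [abs_le] at hr
    have e1 := (le_div_iff₀ hG).mpr (show (-(c : ℚ)) * G ≤ gap U G (fun j => noise r n j J) i by linarith [hr.1])
    have e2 := (div_le_iff₀ hG).mpr (show gap U G (fun j => noise r n j J) i ≤ (c : ℚ) * G by linarith [hr.2])
    constructor <;> linarith
  have hdm : ∀ b, (b * n + i) % n = i ∧ (b * n + i) / n = b := fun b =>
    ⟨by rw [Nat.mul_add_mod_of_lt i.2], by
      rw [Nat.add_div_of_dvd_right (Dvd.intro_left b rfl), Nat.mul_div_cancel _ i.pos,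
        Nat.div_eq_of_lt i.2, add_zero]⟩
  have hbm : ∀ b < J, b * n + i < m := fun b hb => by
    have : (b + 1) * n ≤ J * n := Nat.mul_le_mul_right _ hb
    rw [add_mul] at this
    have := i.2
    omega
  have hcard : ((S ×ˢ (Finset.univ : Finset (Fin J → Bool))).card) ≤
      ((Finset.univ : Finset (Fin m → Bool)) ×ˢ Finset.range (2 * c + 1)).card := by
    apply Finset.card_le_card_of_injOn (fun p => (flip p, key p.1))
    · rintro ⟨r, s⟩ hp
      simp only [Finset.coe_product, Set.mem_prod, Finset.mem_coe] at hp
      simp only [Finset.coe_product, Set.mem_prod, Finset.mem_coe, Finset.mem_univ,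
        Finset.mem_range, true_and, key]
      rw [Nat.lt_succ_iff]
      exact Nat.floor_le_of_le (by push_cast; exact (hkey r hp.1).2)
    · rintro ⟨r, s⟩ hp ⟨r', s'⟩ hp' heq
      simp only [Finset.coe_product, Set.mem_prod, Finset.mem_coe] at hp hp'
      obtain ⟨hf, hk⟩ := Prod.mk.inj heq
      have hss : s = s' := by
        funext b
        have := congrFun hf ⟨b * n + i, hbm b b.2⟩
        simpa only [flip, (hdm b).1, (hdm b).2, b.2, true_and, dif_pos] using this
      have hout : ∀ k : Fin m, ¬ (k.1 % n = i ∧ k.1 / n < J) → r k = r' k := by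
        intro k hk
        have := congrFun hf k
        simpa only [flip, hk, dif_neg, not_false_eq_true] using this
      have hgg := gap_sub_gap U G (ξ := fun j : Fin n => noise r n j J)
        (ξ' := fun j : Fin n => noise r' n j J) (i := i) fun j hj => by
          refine noise_congr hm hm j.2 fun b hb h1 _ => hout _ ?_
          rintro ⟨h2, -⟩
          rw [Nat.mul_add_mod_of_lt j.2] at h2
          exact hj (Fin.ext h2)
      have hnoise : noise r n i J = noise r' n i J := by
        obtain ⟨h1, h2⟩ := hkey r hp.1
        obtain ⟨h1', h2'⟩ := hkey r' hp'.1
        have f1 := Nat.floor_le h1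
        have f2 := Nat.lt_floor_add_one (gap U G (fun j => noise r n j J) i / G + c)
        have f1' := Nat.floor_le h1'
        have f2' := Nat.lt_floor_add_one (gap U G (fun j => noise r' n j J) i / G + c)
        simp only [key] at hk
        rw [← hk] at f1' f2'
        have e : gap U G (fun j => noise r n j J) i / G =
            gap U G (fun j => noise r' n j J) i / G + ((noise r n i J : ℚ) - noise r' n i J) := by
          rw [hgg]
          field_simp
        have a1 : (noise r n i J : ℚ) < noise r' n i J + 1 := by linarith
        have a2 : (noise r' n i J : ℚ) < noise r n i J + 1 := by linarith
        norm_cast at a1 a2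
        omega
      have hrr : r = r' := by
        funext k
        by_cases hk : k.1 % n = i ∧ k.1 / n < J
        · have e : k.1 / n * n + i = k := by
            rw [← hk.1, mul_comm]
            exact Nat.div_add_mod _ _
          have := noise_injective hnoise (k.1 / n) hk.2 (by rw [e]; exact k.2)
          simpa only [e] using this
        · exact hout k hk
      rw [hrr, hss]
  simpa [Finset.card_product] using hcard

/-! ## Expectations over coin tosses -/

theorem expect_coins_castLE {a m : ℕ} (h : a ≤ m) (f : (Fin a → Bool) → ℚ) :
    Finset.univ.expect (fun r : Fin m → Bool => f fun k => r (Fin.castLE h k)) =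
      Finset.univ.expect f := by
  obtain ⟨b, rfl⟩ := Nat.exists_eq_add_of_le h
  have e := Fintype.expect_equiv (Fin.appendEquiv a b (α := Bool)).symm
    (fun r : Fin (a + b) → Bool => f fun k => r (Fin.castLE h k))
    (fun p : (Fin a → Bool) × (Fin b → Bool) => f p.1) (fun r => rfl)
  rw [e, ← Finset.univ_product_univ, Finset.expect_product]
  exact Finset.expect_congr rfl fun i _ => Fintype.expect_const (f i)

theorem expect_coins_noise {n a m J : ℕ} (ha : J * n ≤ a) (hm : J * n ≤ m)
    (f : (Fin n → ℕ) → ℚ) :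
    Finset.univ.expect (fun r : Fin m → Bool => f fun i => noise r n i J) =
      Finset.univ.expect (fun r : Fin a → Bool => f fun i => noise r n i J) := by
  have key : ∀ m, (hm : J * n ≤ m) →
      Finset.univ.expect (fun r : Fin m → Bool => f fun i => noise r n i J) =
      Finset.univ.expect (fun r : Fin (J * n) → Bool => f fun i => noise r n i J) := by
    intro m hm
    rw [← expect_coins_castLE hm]
    refine Finset.expect_congr rfl fun r _ => congrArg f (funext fun i => ?_)
    exact noise_congr hm le_rfl i.2 fun b _ h1 h2 => rfl
  rw [key m hm, key a ha]

/-! ## Follow the perturbed leader with rounded profits -/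

variable {I : Inst}

def cumPayoff (I : Inst) (h : List (State I)) (x : Finset (Fin I.n)) : ℚ :=
  (h.map (payoff I x)).sum

def totalProfit (h : List (State I)) (i : Fin I.n) : ℚ := (h.map fun y => y.profit i).sum

def totalPenalty (h : List (State I)) (w : ℚ) : ℚ :=
  (h.map fun y => I.c * max 0 (w - y.B)).sum

/-- The total profit of an item, rounded down to a multiple of the payoff diameter. -/
def profitUnits (h : List (State I)) (i : Fin I.n) : ℕ := ⌊totalProfit h i / payoffRange I⌋₊

/-- The cumulative payoff with rounded profits. -/
def roundedPayoff (h : List (State I)) (x : Finset (Fin I.n)) : ℚ :=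
  payoffRange I * ∑ i ∈ x, (profitUnits h i : ℚ) - totalPenalty h (∑ i ∈ x, I.w i)

/-- `x` maximizes the rounded cumulative payoff perturbed by `ξ`. -/
def IsLeader (h : List (State I)) (ξ : Fin I.n → ℕ) (x : Finset (Fin I.n)) : Prop :=
  ∀ z, perturb (roundedPayoff h) (payoffRange I) ξ z ≤
    perturb (roundedPayoff h) (payoffRange I) ξ x

theorem exists_isLeader (h : List (State I)) (ξ : Fin I.n → ℕ) : ∃ x, IsLeader h ξ x := by
  obtain ⟨x, -, hx⟩ := Finset.exists_max_image Finset.univ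
    (perturb (roundedPayoff h) (payoffRange I) ξ) Finset.univ_nonempty
  exact ⟨x, fun z => hx z (Finset.mem_univ z)⟩

noncomputable def leader (h : List (State I)) (ξ : Fin I.n → ℕ) : Finset (Fin I.n) :=
  (exists_isLeader h ξ).choose

theorem isLeader_leader (h : List (State I)) (ξ : Fin I.n → ℕ) : IsLeader h ξ (leader h ξ) :=
  (exists_isLeader h ξ).choose_spec

theorem payoffRange_nonneg (I : Inst) : 0 ≤ payoffRange I :=
  add_nonneg (mul_nonneg (Nat.cast_nonneg _) I.P_nonneg)
    (mul_nonneg I.c_nonneg (Finset.sum_nonneg fun i _ => I.w_nonneg i))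

theorem abs_payoff_sub_le (x x' : Finset (Fin I.n)) (y y' : State I) :
    |payoff I x y - payoff I x' y'| ≤ payoffRange I :=
  (isGreatest_payoffRange I).2 ⟨x, x', y, y', rfl⟩

theorem penalty_nonneg (w : ℚ) (y : State I) : 0 ≤ I.c * max 0 (w - y.B) :=
  mul_nonneg I.c_nonneg (le_max_left _ _)

theorem penalty_le (x : Finset (Fin I.n)) (y : State I) :
    I.c * max 0 (∑ i ∈ x, I.w i - y.B) ≤ I.c * ∑ i, I.w i := by
  refine mul_le_mul_of_nonneg_left (max_le ?_ ?_) I.c_nonneg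
  · exact Finset.sum_nonneg fun i _ => I.w_nonneg i
  · have := Finset.sum_le_sum_of_subset_of_nonneg (Finset.subset_univ x)
      fun i _ _ => I.w_nonneg i
    linarith [y.B_nonneg]

theorem abs_payoff_le (x : Finset (Fin I.n)) (y : State I) :
    |payoff I x y| ≤ payoffRange I := by
  have h := abs_payoff_sub_le x x y ⟨fun _ => 0, fun _ => le_rfl, fun _ => I.P_nonneg, 0, le_rfl⟩
  have h1 : 0 ≤ ∑ i ∈ x, y.profit i := Finset.sum_nonneg fun i _ => y.profit_nonneg i
  have h2 : ∑ i ∈ x, y.profit i ≤ I.n * I.P := by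
    calc ∑ i ∈ x, y.profit i ≤ ∑ i, y.profit i :=
          Finset.sum_le_sum_of_subset_of_nonneg (Finset.subset_univ x)
            fun i _ _ => y.profit_nonneg i
      _ ≤ ∑ _i : Fin I.n, I.P := Finset.sum_le_sum fun i _ => y.profit_le i
      _ = I.n * I.P := by simp
  have h3 := penalty_le x y
  have h4 := penalty_nonneg (∑ i ∈ x, I.w i) y
  have h5 : 0 ≤ I.c * ∑ i, I.w i :=
    mul_nonneg I.c_nonneg (Finset.sum_nonneg fun i _ => I.w_nonneg i)
  have h6 : 0 ≤ (I.n : ℚ) * I.P := mul_nonneg (Nat.cast_nonneg _) I.P_nonneg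
  unfold payoff payoffRange
  rw [abs_le]
  constructor <;> linarith

theorem totalProfit_nonneg (h : List (State I)) (i : Fin I.n) : 0 ≤ totalProfit h i :=
  List.sum_nonneg fun q hq => by
    obtain ⟨y, -, rfl⟩ := List.mem_map.mp hq
    exact y.profit_nonneg i

theorem cumPayoff_eq (h : List (State I)) (x : Finset (Fin I.n)) :
    cumPayoff I h x = ∑ i ∈ x, totalProfit h i - totalPenalty h (∑ i ∈ x, I.w i) := by
  induction h with
  | nil => simp [cumPayoff, totalProfit, totalPenalty]
  | cons y h ih =>
    simp only [cumPayoff, totalProfit, totalPenalty, List.map_cons, List.sum_cons,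
      Finset.sum_add_distrib] at ih ⊢
    rw [ih, payoff]
    ring

theorem cumPayoff_append (h : List (State I)) (y : State I) (x : Finset (Fin I.n)) :
    cumPayoff I (h ++ [y]) x = cumPayoff I h x + payoff I x y := by
  simp [cumPayoff]

theorem roundedPayoff_le (hG : 0 < payoffRange I) (h : List (State I)) (x : Finset (Fin I.n)) :
    roundedPayoff h x ≤ cumPayoff I h x := by
  rw [cumPayoff_eq, roundedPayoff, Finset.mul_sum]
  have : ∑ i ∈ x, payoffRange I * (profitUnits h i : ℚ) ≤ ∑ i ∈ x, totalProfit h i := by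
    refine Finset.sum_le_sum fun i _ => ?_
    rw [mul_comm, ← le_div_iff₀ hG]
    exact Nat.floor_le (div_nonneg (totalProfit_nonneg h i) hG.le)
  linarith

theorem cumPayoff_le (hG : 0 < payoffRange I) (h : List (State I)) (x : Finset (Fin I.n)) :
    cumPayoff I h x ≤ roundedPayoff h x + I.n * payoffRange I := by
  rw [cumPayoff_eq, roundedPayoff, Finset.mul_sum]
  have h1 : ∑ i ∈ x, totalProfit h i ≤
      ∑ i ∈ x, (payoffRange I * (profitUnits h i : ℚ) + payoffRange I) := by
    refine Finset.sum_le_sum fun i _ => ?_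
    have := Nat.lt_floor_add_one (totalProfit h i / payoffRange I)
    rw [div_lt_iff₀ hG] at this
    unfold profitUnits
    linarith
  have h2 : (x.card : ℚ) * payoffRange I ≤ I.n * payoffRange I := by
    refine mul_le_mul_of_nonneg_right ?_ hG.le
    exact_mod_cast (Finset.card_le_univ x).trans_eq (Fintype.card_fin _)
  rw [Finset.sum_add_distrib, Finset.sum_const, nsmul_eq_mul] at h1
  linarith

/-- One more round changes the rounded payoff by a bounded amount. -/
theorem roundedPayoff_append_sub (hG : 0 < payoffRange I) (h : List (State I)) (y : State I)
    (x x' : Finset (Fin I.n)) :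
    roundedPayoff (h ++ [y]) x' - roundedPayoff h x' -
      (roundedPayoff (h ++ [y]) x - roundedPayoff h x) ≤ payoffRange I * ((I.n + 1 : ℕ) : ℚ) := by
  have hunit : ∀ i, (profitUnits h i : ℚ) ≤ profitUnits (h ++ [y]) i ∧
      (profitUnits (h ++ [y]) i : ℚ) ≤ profitUnits h i + 1 := by
    intro i
    have e : totalProfit (h ++ [y]) i = totalProfit h i + y.profit i := by simp [totalProfit]
    have hP : y.profit i ≤ payoffRange I := by
      refine (y.profit_le i).trans ?_
      have h1 : (1 : ℚ) ≤ I.n := by exact_mod_cast i.pos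
      have h2 : 0 ≤ I.c * ∑ i, I.w i :=
        mul_nonneg I.c_nonneg (Finset.sum_nonneg fun i _ => I.w_nonneg i)
      unfold payoffRange
      nlinarith [I.P_nonneg]
    have h0 := div_nonneg (totalProfit_nonneg h i) hG.le
    unfold profitUnits
    rw [e]
    constructor
    · exact_mod_cast Nat.floor_mono
        (div_le_div_of_nonneg_right (by linarith [y.profit_nonneg i]) hG.le)
    · have : ⌊(totalProfit h i + y.profit i) / payoffRange I⌋₊ ≤
          ⌊totalProfit h i / payoffRange I + (1 : ℕ)⌋₊ := by
        refine Nat.floor_mono ?_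
        rw [add_div]
        have := (div_le_one hG).mpr hP
        push_cast
        linarith
      rw [Nat.floor_add_natCast h0] at this
      exact_mod_cast this
  have hpen : ∀ w, totalPenalty (h ++ [y]) w = totalPenalty h w + I.c * max 0 (w - y.B) := by
    intro w
    simp [totalPenalty]
  have h1 : ∑ i ∈ x', (profitUnits (h ++ [y]) i : ℚ) ≤
      ∑ i ∈ x', (profitUnits h i : ℚ) + I.n := by
    have h1 := Finset.sum_le_sum fun i (_ : i ∈ x') => (hunit i).2
    have h2 : (x'.card : ℚ) ≤ I.n := by
      exact_mod_cast (Finset.card_le_univ x').trans_eq (Fintype.card_fin _)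
    rw [Finset.sum_add_distrib, Finset.sum_const, nsmul_eq_mul, mul_one] at h1
    linarith
  have h2 := Finset.sum_le_sum fun i (_ : i ∈ x) => (hunit i).1
  have h3 := penalty_nonneg (∑ i ∈ x', I.w i) y
  have h4 := penalty_le x y
  have h5 : I.c * ∑ i, I.w i ≤ payoffRange I := by
    have : 0 ≤ (I.n : ℚ) * I.P := mul_nonneg (Nat.cast_nonneg _) I.P_nonneg
    unfold payoffRange
    linarith
  have h6 := mul_le_mul_of_nonneg_left h1 hG.le
  have h7 := mul_le_mul_of_nonneg_left h2 hG.le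
  unfold roundedPayoff
  rw [hpen, hpen]
  push_cast
  linarith

/-- The perturbed cumulative payoff of the leader. -/
noncomputable def leaderValue (h : List (State I)) (ξ : Fin I.n → ℕ) : ℚ :=
  perturb (cumPayoff I h) (payoffRange I) ξ (leader h ξ)

/-- The expected perturbed cumulative payoff of the leader, for perturbations of `J` bits. -/
noncomputable def expectedLeaderValue (J : ℕ) (h : List (State I)) : ℚ :=
  Finset.univ.expect fun r : Fin (J * I.n) → Bool => leaderValue h fun i => noise r I.n i J

theorem leaderValue_append_le (hG : 0 < payoffRange I) (h : List (State I)) (y : State I)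
    (ξ : Fin I.n → ℕ) :
    leaderValue (h ++ [y]) ξ ≤ leaderValue h ξ + (I.n + 1) * payoffRange I := by
  have h1 := isLeader_leader h ξ (leader (h ++ [y]) ξ)
  have h2 := roundedPayoff_le hG h (leader h ξ)
  have h3 := cumPayoff_le hG h (leader (h ++ [y]) ξ)
  have h4 := (abs_le.mp (abs_payoff_le (leader (h ++ [y]) ξ) y)).2
  unfold leaderValue perturb at *
  rw [cumPayoff_append]
  linarith

theorem cumPayoff_le_leaderValue (hG : 0 < payoffRange I) (h : List (State I))
    (ξ : Fin I.n → ℕ) (x : Finset (Fin I.n)) :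
    cumPayoff I h x ≤ leaderValue h ξ + I.n * payoffRange I := by
  have h1 := isLeader_leader h ξ x
  have h2 := roundedPayoff_le hG h (leader h ξ)
  have h3 := cumPayoff_le hG h x
  have h4 : 0 ≤ payoffRange I * ∑ i ∈ x, (ξ i : ℚ) :=
    mul_nonneg hG.le (Finset.sum_nonneg fun i _ => Nat.cast_nonneg _)
  unfold leaderValue perturb at *
  linarith

theorem leaderValue_le (hG : 0 < payoffRange I) (h : List (State I)) {ξ : Fin I.n → ℕ} {K : ℕ}
    (hξ : ∀ i, ξ i ≤ K) :
    leaderValue h ξ ≤ cumPayoff I h (leader h ξ) + I.n * payoffRange I * K := by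
  have h1 : ∑ i ∈ leader h ξ, (ξ i : ℚ) ≤ I.n * K := by
    calc ∑ i ∈ leader h ξ, (ξ i : ℚ) ≤ ∑ i, (ξ i : ℚ) :=
          Finset.sum_le_sum_of_subset_of_nonneg (Finset.subset_univ _)
            fun i _ _ => Nat.cast_nonneg _
      _ ≤ ∑ _i : Fin I.n, (K : ℚ) := Finset.sum_le_sum fun i _ => by exact_mod_cast hξ i
      _ = I.n * K := by simp
  have := mul_le_mul_of_nonneg_left h1 hG.le
  unfold leaderValue perturb
  linarith

/-- The expected payoff of a leader in the next round is almost the increase of the potential. -/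
theorem expect_payoff_leader_ge (hG : 0 < payoffRange I) {m J : ℕ} (hm : J * I.n ≤ m)
    (h : List (State I)) (y : State I) (act : (Fin m → Bool) → Finset (Fin I.n))
    (hact : ∀ r, IsLeader h (fun i => noise r I.n i J) (act r)) :
    expectedLeaderValue J (h ++ [y]) - expectedLeaderValue J h -
      payoffRange I * ((I.n + 2) * I.n * (2 * I.n + 3)) / 2 ^ J ≤
      Finset.univ.expect fun r => payoff I (act r) y := by
  classical
  set G := payoffRange I with hGdef
  let ξ : (Fin m → Bool) → Fin I.n → ℕ := fun r i => noise r I.n i J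
  let bad : Fin I.n → (Fin m → Bool) → Prop := fun i r =>
    |gap (roundedPayoff h) G (ξ r) i| ≤ G * ((I.n + 1 : ℕ) : ℚ)
  have hpt : ∀ r, leaderValue (h ++ [y]) (ξ r) - leaderValue h (ξ r) -
      G * (I.n + 2) * ∑ i, (if bad i r then 1 else 0) ≤ payoff I (act r) y := by
    intro r
    have hsum : ∀ i, (0 : ℚ) ≤ if bad i r then 1 else 0 := fun i => by split_ifs <;> norm_num
    by_cases hb : ∀ i, ¬ bad i r
    · have hb' : ∀ i, G * ((I.n + 1 : ℕ) : ℚ) < |gap (roundedPayoff h) G (ξ r) i| :=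
        fun i => not_le.mp (hb i)
      have e1 : act r = leader (h ++ [y]) (ξ r) :=
        leader_eq_of_gap hb' (roundedPayoff_append_sub hG h y) (hact r) (isLeader_leader _ _)
      have e2 : leader h (ξ r) = leader (h ++ [y]) (ξ r) :=
        leader_eq_of_gap hb' (roundedPayoff_append_sub hG h y) (isLeader_leader _ _)
          (isLeader_leader _ _)
      have : 0 ≤ G * (I.n + 2) * ∑ i, (if bad i r then (1 : ℚ) else 0) :=
        mul_nonneg (mul_nonneg hG.le (by positivity)) (Finset.sum_nonneg fun i _ => hsum i)
      unfold leaderValue perturb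
      rw [cumPayoff_append, e2, e1]
      linarith
    · push Not at hb
      obtain ⟨i, hi⟩ := hb
      have h1 : (1 : ℚ) ≤ ∑ i, (if bad i r then (1 : ℚ) else 0) := by
        have := Finset.single_le_sum (fun i _ => hsum i) (Finset.mem_univ i)
        rwa [if_pos hi] at this
      have h2 := leaderValue_append_le hG h y (ξ r)
      have h3 := (abs_le.mp (abs_payoff_le (act r) y)).1
      have h4 := mul_le_mul_of_nonneg_left h1
        (mul_nonneg hG.le (by positivity : (0 : ℚ) ≤ I.n + 2))
      linarith
  have hbad : ∀ i, Finset.univ.expect (fun r => if bad i r then (1 : ℚ) else 0) ≤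
      (2 * I.n + 3) / 2 ^ J := by
    intro i
    have := card_small_gap_mul_le (roundedPayoff h) hG (I.n + 1) i hm
    rw [Fintype.expect_eq_sum_div_card, Finset.sum_boole, div_le_div_iff₀ (by positivity)
      (by positivity)]
    simp only [Fintype.card_fun, Fintype.card_bool, Fintype.card_fin]
    have e : (2 : ℚ) * I.n + 3 = ((2 * (I.n + 1) + 1 : ℕ) : ℚ) := by push_cast; ring
    rw [e, mul_comm _ (((2 ^ m : ℕ)) : ℚ)]
    exact_mod_cast this
  have hE := Finset.expect_le_expect fun r (_ : r ∈ Finset.univ) => hpt r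
  rw [Finset.expect_sub_distrib, Finset.expect_sub_distrib, ← Finset.mul_expect,
    Finset.expect_sum_comm] at hE
  have hs := Finset.sum_le_sum fun i (_ : i ∈ Finset.univ) => hbad i
  rw [Finset.sum_const, Finset.card_univ, Fintype.card_fin, nsmul_eq_mul] at hs
  have hs' := mul_le_mul_of_nonneg_left hs
    (mul_nonneg hG.le (by positivity : (0 : ℚ) ≤ I.n + 2))
  unfold expectedLeaderValue
  rw [expect_coins_noise hm le_rfl, expect_coins_noise hm le_rfl]
  refine le_trans ?_ hE
  have e : G * ((I.n + 2) * I.n * (2 * I.n + 3)) / 2 ^ J =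
      G * (I.n + 2) * (I.n * ((2 * I.n + 3) / 2 ^ J)) := by ring
  rw [e]
  linarith

variable {I : Inst}

/-- The number of random bits per item after `t` rounds. -/
def noiseBits (t : ℕ) : ℕ := Nat.log 4 (t + 1)

theorem four_pow_noiseBits_le (t : ℕ) : 4 ^ noiseBits t ≤ t + 1 :=
  Nat.pow_log_le_self 4 (Nat.succ_ne_zero t)

theorem lt_four_pow_noiseBits (t : ℕ) : t + 1 < 4 ^ (noiseBits t + 1) :=
  Nat.lt_pow_succ_log_self (by norm_num) _

theorem noiseBits_succ (t : ℕ) : noiseBits (t + 1) = noiseBits t ∨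
    (noiseBits (t + 1) = noiseBits t + 1 ∧ t + 2 = 4 ^ (noiseBits t + 1)) := by
  have h1 := lt_four_pow_noiseBits t
  have h2 := four_pow_noiseBits_le (t + 1)
  have h3 := lt_four_pow_noiseBits (t + 1)
  have h4 := four_pow_noiseBits_le t
  have hle : noiseBits t ≤ noiseBits (t + 1) := Nat.log_mono_right (by omega)
  rcases hle.eq_or_lt with h | h
  · exact Or.inl h.symm
  · have h5 : 4 ^ (noiseBits t + 1) ≤ 4 ^ noiseBits (t + 1) :=
      Nat.pow_le_pow_right (by norm_num) h
    have h6 : t + 2 = 4 ^ (noiseBits t + 1) := by omega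
    refine Or.inr ⟨?_, h6⟩
    have : 4 ^ noiseBits (t + 1) = 4 ^ (noiseBits t + 1) := by omega
    exact Nat.pow_right_injective (le_refl 2 |>.trans (by norm_num)) this

/-- The accumulated loss per unit of the payoff diameter, where `a` bounds the loss in one round
times the noise level and `b` the cost of a change of the noise level. -/
def lossBound (a b : ℚ) (t : ℕ) : ℚ := a * ((t + 1) / 2 ^ noiseBits t) + b * 2 ^ noiseBits t

theorem lossBound_succ_same {a b : ℚ} {t : ℕ} (h : noiseBits (t + 1) = noiseBits t) :
    lossBound a b t + a / 2 ^ noiseBits t = lossBound a b (t + 1) := by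
  unfold lossBound
  rw [h]
  push_cast
  ring

theorem lossBound_succ_change {a b : ℚ} (ha : 0 ≤ a) {t : ℕ}
    (h : noiseBits (t + 1) = noiseBits t + 1) (h4 : t + 2 = 4 ^ (noiseBits t + 1)) :
    lossBound a (b + 3 * a) t + a / 2 ^ noiseBits t + b * 2 ^ noiseBits t ≤
      lossBound a (b + 3 * a) (t + 1) := by
  unfold lossBound
  rw [h]
  have hK : (1 : ℚ) ≤ 2 ^ noiseBits t := one_le_pow₀ (by norm_num)
  have e4 : ((t : ℚ) + 1) + 1 = 4 * (2 ^ noiseBits t) ^ 2 := by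
    have : ((t + 2 : ℕ) : ℚ) = ((4 ^ (noiseBits t + 1) : ℕ) : ℚ) := by rw [h4]
    push_cast at this
    rw [← pow_mul, mul_comm (noiseBits t), pow_mul]
    norm_num
    rw [pow_succ] at this
    linarith
  set K : ℚ := 2 ^ noiseBits t
  push_cast
  rw [e4, show (2 : ℚ) ^ (noiseBits t + 1) = K * 2 from pow_succ _ _, show (t : ℚ) + 1 = 4 * K ^ 2 - 1 by linarith]
  have hK0 : K ≠ 0 := by positivity
  have e1 : (4 * K ^ 2 - 1) / K = 4 * K - 1 / K := by field_simp
  have e2 : 4 * K ^ 2 / (K * 2) = 2 * K := by field_simp; ring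
  rw [e1, e2]
  have : a * (1 / K) = a / K := by ring
  nlinarith [mul_nonneg ha (by linarith : 0 ≤ K)]

theorem lossBound_le {a b : ℚ} (ha : 0 ≤ a) (t : ℕ) :
    lossBound a b t ≤ (4 * a + b) * 2 ^ noiseBits t := by
  have h := lt_four_pow_noiseBits t
  have h' : (t : ℚ) + 1 ≤ 4 * (2 ^ noiseBits t) ^ 2 := by
    have : ((t + 1 : ℕ) : ℚ) ≤ ((4 ^ (noiseBits t + 1) : ℕ) : ℚ) := by exact_mod_cast h.le
    push_cast at this
    rw [← pow_mul, mul_comm (noiseBits t), pow_mul]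
    norm_num
    rw [pow_succ] at this
    linarith
  unfold lossBound
  have hK : (0 : ℚ) < 2 ^ noiseBits t := by positivity
  have : ((t : ℚ) + 1) / 2 ^ noiseBits t ≤ 4 * 2 ^ noiseBits t := by
    rw [div_le_iff₀ hK]
    linarith
  have := mul_le_mul_of_nonneg_left this ha
  linarith

theorem expectedLeaderValue_change (hG : 0 < payoffRange I) (h : List (State I)) (J : ℕ) :
    expectedLeaderValue (J + 1) h ≤
      expectedLeaderValue J h + payoffRange I * (3 * I.n * 2 ^ J) := by
  obtain ⟨x, -, hx⟩ := Finset.exists_max_image Finset.univ (cumPayoff I h) Finset.univ_nonempty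
  have hup : expectedLeaderValue (J + 1) h ≤
      cumPayoff I h x + I.n * payoffRange I * ((2 ^ (J + 1) - 1 : ℕ) : ℚ) := by
    unfold expectedLeaderValue
    refine Finset.expect_le Finset.univ_nonempty fun r _ => ?_
    refine (leaderValue_le hG h fun i => Nat.le_sub_one_of_lt (noise_lt r I.n i (J + 1))).trans ?_
    linarith [hx (leader h fun i => noise r I.n i (J + 1)) (Finset.mem_univ _)]
  have hlo : cumPayoff I h x - I.n * payoffRange I ≤ expectedLeaderValue J h := by
    unfold expectedLeaderValue
    refine Finset.le_expect Finset.univ_nonempty fun r _ => ?_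
    linarith [cumPayoff_le_leaderValue hG h (fun i => noise r I.n i J) x]
  rw [Nat.cast_sub Nat.one_le_two_pow] at hup
  push_cast at hup
  rw [pow_succ] at hup
  have h0 : 0 ≤ I.n * payoffRange I := mul_nonneg (Nat.cast_nonneg _) hG.le
  have h1 : (0 : ℚ) ≤ 2 ^ J := by positivity
  nlinarith [mul_nonneg h0 h1]

/-- The loss in one round, times the noise level, per unit of the payoff diameter. -/
def roundLoss (n : ℕ) : ℕ := (n + 2) * n * (2 * n + 3)

theorem regret_le (hG : 0 < payoffRange I) (h : List (Finset (Fin I.n) × State I)) (J : ℕ) :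
    regret I h ≤ expectedLeaderValue J (h.map Prod.snd) + I.n * payoffRange I -
      (h.map fun r => payoff I r.1 r.2).sum := by
  unfold regret
  refine sub_le_sub_right (Finset.sup'_le _ _ fun x _ => ?_) _
  have e : (h.map fun r => payoff I x r.2).sum = cumPayoff I (h.map Prod.snd) x := by
    simp [cumPayoff, Function.comp_def]
  rw [e]
  unfold expectedLeaderValue
  rw [← sub_le_iff_le_add]
  refine Finset.le_expect Finset.univ_nonempty fun r _ => ?_
  linarith [cumPayoff_le_leaderValue hG (h.map Prod.snd) (fun i => noise r I.n i J) x]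

/-- The algorithm `A` always chooses a perturbed leader. -/
def FollowsLeader (A : OnlineAlgorithm) : Prop :=
  ∀ (I : Inst) (h : List (State I)) (r : Fin (A.coins.eval (inputSize I h)) → Bool),
    noiseBits h.length * I.n ≤ A.coins.eval (inputSize I h) ∧
      IsLeader h (fun i => noise r I.n i (noiseBits h.length)) (A.act I h r)

theorem expectedRegret_le {A : OnlineAlgorithm} (hA : FollowsLeader A) (hG : 0 < payoffRange I)
    (adv : List (Finset (Fin I.n) × State I) → State I) (T : ℕ) :
    ∀ h, A.expectedRegret I adv T h ≤ expectedLeaderValue (noiseBits h.length) (h.map Prod.snd) +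
      I.n * payoffRange I - (h.map fun r => payoff I r.1 r.2).sum +
      payoffRange I * (lossBound (roundLoss I.n) (3 * I.n + 3 * roundLoss I.n) (h.length + T) -
        lossBound (roundLoss I.n) (3 * I.n + 3 * roundLoss I.n) h.length) := by
  induction T with
  | zero =>
    intro h
    have := regret_le hG h (noiseBits h.length)
    simp only [OnlineAlgorithm.expectedRegret, add_zero, sub_self, mul_zero]
    exact this
  | succ T ih =>
    intro h
    set D := lossBound (roundLoss I.n) (3 * I.n + 3 * roundLoss I.n) with hD
    have hstep : ∀ r : Fin (A.coins.eval (inputSize I (h.map Prod.snd))) → Bool,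
        A.expectedRegret I adv T (h ++ [(A.act I (h.map Prod.snd) r, adv h)]) ≤
        (expectedLeaderValue (noiseBits (h.length + 1)) (h.map Prod.snd ++ [adv h]) +
          I.n * payoffRange I - (h.map fun r => payoff I r.1 r.2).sum +
          payoffRange I * (D (h.length + (T + 1)) - D (h.length + 1))) -
          payoff I (A.act I (h.map Prod.snd) r) (adv h) := by
      intro r
      refine (ih _).trans (le_of_eq ?_)
      simp only [List.length_append, List.length_singleton, List.map_append, List.map_singleton,
        List.sum_append, List.sum_singleton]
      rw [show h.length + 1 + T = h.length + (T + 1) by ring]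
      ring
    rw [OnlineAlgorithm.expectedRegret]
    refine (Finset.expect_le_expect fun r _ => hstep r).trans ?_
    rw [Finset.expect_sub_distrib, Fintype.expect_const]
    have hA' := hA I (h.map Prod.snd)
    rw [List.length_map] at hA'
    have hg := expect_payoff_leader_ge hG (hA' fun _ => false).1 (h.map Prod.snd) (adv h)
      (A.act I (h.map Prod.snd)) fun r => (hA' r).2
    have hchange : expectedLeaderValue (noiseBits (h.length + 1)) (h.map Prod.snd ++ [adv h]) +
        payoffRange I * (D h.length + roundLoss I.n / 2 ^ noiseBits h.length) ≤
        expectedLeaderValue (noiseBits h.length) (h.map Prod.snd ++ [adv h]) +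
        payoffRange I * D (h.length + 1) := by
      rcases noiseBits_succ h.length with e | ⟨e, e4⟩
      · rw [e, hD, lossBound_succ_same e]
      · have h1 := lossBound_succ_change (a := roundLoss I.n) (b := 3 * I.n)
          (Nat.cast_nonneg _) e e4
        have h2 := mul_le_mul_of_nonneg_left h1 hG.le
        have h3 := expectedLeaderValue_change hG (h.map Prod.snd ++ [adv h]) (noiseBits h.length)
        rw [e]
        linarith
    have e : payoffRange I * ((I.n + 2) * I.n * (2 * I.n + 3)) / 2 ^ noiseBits h.length =
        payoffRange I * (roundLoss I.n / 2 ^ noiseBits h.length) := by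
      unfold roundLoss
      push_cast
      ring
    rw [e] at hg
    linarith

theorem expectedRegret_le_of_payoffRange_eq_zero {A : OnlineAlgorithm} (hG : payoffRange I = 0)
    (adv : List (Finset (Fin I.n) × State I) → State I) (T : ℕ) :
    ∀ h, A.expectedRegret I adv T h ≤ 0 := by
  have h0 : ∀ (x : Finset (Fin I.n)) (y : State I), payoff I x y = 0 := fun x y =>
    abs_nonpos_iff.mp (hG ▸ abs_payoff_le x y)
  induction T with
  | zero =>
    intro h
    simp [OnlineAlgorithm.expectedRegret, regret, h0]
  | succ T ih =>
    intro h
    rw [OnlineAlgorithm.expectedRegret]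
    exact (Finset.expect_le_expect fun r _ => ih _).trans_eq (Fintype.expect_const 0)

theorem expectedLeaderValue_nil : expectedLeaderValue 0 ([] : List (State I)) = 0 := by
  unfold expectedLeaderValue leaderValue perturb
  simp [noise, cumPayoff]

/-- Following the perturbed leader has vanishing regret. -/
theorem FollowsLeader.vanishingRegret {A : OnlineAlgorithm} (hA : FollowsLeader A) :
    A.VanishingRegret := by
  refine ⟨2 * (4 * Polynomial.X + 7 * ((Polynomial.X + 2) * Polynomial.X * (2 * Polynomial.X + 3))),
    1 / 2, by norm_num, by norm_num, fun I adv T => ?_⟩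
  have hp : ((2 * (4 * Polynomial.X + 7 * ((Polynomial.X + 2) * Polynomial.X *
      (2 * Polynomial.X + 3))) : Polynomial ℕ).eval I.n) = 2 * (4 * I.n + 7 * roundLoss I.n) := by
    simp [roundLoss]
  rw [hp, ← Real.sqrt_eq_rpow]
  rcases (payoffRange_nonneg I).eq_or_lt with hG | hG
  · rw [← hG]
    have := expectedRegret_le_of_payoffRange_eq_zero (A := A) hG.symm adv T []
    simpa using this
  · rcases T.eq_zero_or_pos with rfl | hT
    · simp [OnlineAlgorithm.expectedRegret, regret]
    · have h1 := expectedRegret_le hA hG adv T []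
      have e0 : noiseBits 0 = 0 := by simp [noiseBits]
      simp only [List.length_nil, List.map_nil, List.sum_nil, zero_add, e0,
        expectedLeaderValue_nil] at h1
      have h2 := lossBound_le (a := roundLoss I.n) (b := 3 * I.n + 3 * roundLoss I.n)
        (Nat.cast_nonneg _) T
      have h3 : 0 ≤ lossBound (roundLoss I.n) (3 * I.n + 3 * roundLoss I.n) 0 := by
        unfold lossBound
        positivity
      have hK : (1 : ℚ) ≤ 2 ^ noiseBits T := one_le_pow₀ (by norm_num)
      have h4 : A.expectedRegret I adv T [] ≤
          (4 * I.n + 7 * roundLoss I.n : ℕ) * payoffRange I * 2 ^ noiseBits T := by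
        have h5 := mul_le_mul_of_nonneg_left (sub_le_self _ h3 |>.trans h2) hG.le
        have h6 := mul_le_mul_of_nonneg_left hK
          (mul_nonneg (Nat.cast_nonneg I.n) hG.le : (0 : ℚ) ≤ I.n * payoffRange I)
        push_cast
        linarith
      have h7 : (2 : ℝ) ^ noiseBits T ≤ 2 * Real.sqrt T := by
        have h8 : ((4 ^ noiseBits T : ℕ) : ℝ) ≤ ((T + 1 : ℕ) : ℝ) := by
          exact_mod_cast four_pow_noiseBits_le T
        have h9 : (1 : ℝ) ≤ T := by exact_mod_cast hT
        refine (pow_le_pow_iff_left₀ (by positivity) (by positivity) two_ne_zero).mp ?_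
        rw [mul_pow, Real.sq_sqrt (Nat.cast_nonneg T), ← pow_mul, mul_comm, pow_mul]
        push_cast at h8
        norm_num
        linarith
      have h10 : (A.expectedRegret I adv T [] : ℝ) ≤
          (4 * I.n + 7 * roundLoss I.n : ℕ) * (payoffRange I : ℝ) * 2 ^ noiseBits T := by
        exact_mod_cast h4
      refine h10.trans ?_
      have h11 : (0 : ℝ) ≤ (4 * I.n + 7 * roundLoss I.n : ℕ) * (payoffRange I : ℝ) :=
        mul_nonneg (Nat.cast_nonneg _) (by exact_mod_cast hG.le)
      refine (mul_le_mul_of_nonneg_left h7 h11).trans (le_of_eq ?_)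
      push_cast
      ring

/-! ## Bit lengths of rationals -/

theorem natSize_mul_le (a b : ℕ) : (a * b).size ≤ a.size + b.size := by
  rw [Nat.size_le, pow_add]
  exact Nat.mul_lt_mul'' a.lt_size_self b.lt_size_self

theorem natSize_le_self (a : ℕ) : a.size ≤ a := Nat.size_le.mpr Nat.lt_two_pow_self

theorem ratSize_le_of_eq_div {q : ℚ} {a : ℤ} {b : ℕ} (hb : b ≠ 0) (h : q = a / b) :
    ratSize q ≤ a.natAbs.size + b.size + 1 := by
  have e : q = Rat.divInt a b := by rw [h, Rat.divInt_eq_div]; norm_cast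
  have h1 : q.num ∣ a := e ▸ Rat.num_dvd a (by exact_mod_cast hb)
  have h2 : (q.den : ℤ) ∣ b := e ▸ Rat.den_dvd a b
  have h3 : q.den.size ≤ b.size :=
    Nat.size_le_size (Nat.le_of_dvd (Nat.pos_of_ne_zero hb) (by exact_mod_cast h2))
  have h4 : q.num.natAbs.size ≤ a.natAbs.size := by
    rcases eq_or_ne a 0 with rfl | ha
    · have : q = 0 := by rw [h]; simp
      simp [this]
    · exact Nat.size_le_size (Nat.le_of_dvd (Int.natAbs_pos.mpr ha) (Int.natAbs_dvd_natAbs.mpr h1))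
  unfold ratSize
  omega

theorem ratSize_natCast (k : ℕ) : ratSize (k : ℚ) = k.size + 2 := by
  simp [ratSize]

theorem ratSize_natCast_le (k : ℕ) : ratSize (k : ℚ) ≤ k + 2 := by
  rw [ratSize_natCast]
  exact Nat.add_le_add_right (natSize_le_self k) 2

theorem natSize_add_le (a b : ℕ) : (a + b).size ≤ max a.size b.size + 1 := by
  rw [Nat.size_le, pow_succ]
  have h1 := a.lt_size_self.trans_le (Nat.pow_le_pow_right two_pos (le_max_left a.size b.size))
  have h2 := b.lt_size_self.trans_le (Nat.pow_le_pow_right two_pos (le_max_right a.size b.size))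
  omega

theorem ratSize_add_le (p q : ℚ) : ratSize (p + q) ≤ 2 * (ratSize p + ratSize q) := by
  have h := ratSize_le_of_eq_div (q := p + q) (a := p.num * q.den + q.num * p.den)
    (b := p.den * q.den) (Nat.mul_ne_zero p.den_nz q.den_nz) (by
      have h1 : (p.den : ℚ) ≠ 0 := by exact_mod_cast p.den_nz
      have h2 : (q.den : ℚ) ≠ 0 := by exact_mod_cast q.den_nz
      conv_lhs => rw [← Rat.num_div_den p, ← Rat.num_div_den q]
      push_cast
      field_simp)
  have h1 := natSize_mul_le p.den q.den
  have h2 : (p.num * q.den + q.num * p.den).natAbs.size ≤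
      (p.num.natAbs * q.den + q.num.natAbs * p.den).size := by
    refine Nat.size_le_size ((Int.natAbs_add_le _ _).trans (le_of_eq ?_))
    simp [Int.natAbs_mul]
  have h3 := natSize_add_le (p.num.natAbs * q.den) (q.num.natAbs * p.den)
  have h4 := natSize_mul_le p.num.natAbs q.den
  have h5 := natSize_mul_le q.num.natAbs p.den
  unfold ratSize at *
  omega

theorem ratSize_neg (q : ℚ) : ratSize (-q) = ratSize q := by simp [ratSize]

theorem ratSize_sub_le (p q : ℚ) : ratSize (p - q) ≤ 2 * (ratSize p + ratSize q) := by
  rw [sub_eq_add_neg, ← ratSize_neg q]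
  exact ratSize_add_le _ _

theorem ratSize_mul_le (p q : ℚ) : ratSize (p * q) ≤ 2 * (ratSize p + ratSize q) := by
  have h := ratSize_le_of_eq_div (q := p * q) (a := p.num * q.num)
    (b := p.den * q.den) (Nat.mul_ne_zero p.den_nz q.den_nz) (by
      conv_lhs => rw [← Rat.num_div_den p, ← Rat.num_div_den q]
      push_cast
      rw [div_mul_div_comm])
  have h1 := natSize_mul_le p.den q.den
  have h2 := natSize_mul_le p.num.natAbs q.num.natAbs
  rw [Int.natAbs_mul] at h
  unfold ratSize at *
  omega

theorem ratSize_inv (q : ℚ) : ratSize q⁻¹ ≤ ratSize q + 1 := by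
  rcases eq_or_ne q 0 with rfl | hq
  · simp [ratSize]
  · have hn : q.num.natAbs ≠ 0 := by simpa using hq
    have h := ratSize_le_of_eq_div (q := q⁻¹) (a := q.num.sign * q.den) (b := q.num.natAbs) hn (by
      have hn' : (q.num.natAbs : ℚ) ≠ 0 := by exact_mod_cast hn
      have hd : (q.den : ℚ) ≠ 0 := by exact_mod_cast q.den_nz
      have hq' : (q.num : ℚ) ≠ 0 := by simpa using hq
      have h5 : (q.num.sign : ℚ) * q.num = (q.num.natAbs : ℚ) := by
        rw [← Int.cast_mul, mul_comm, Int.mul_sign_self, Int.cast_natCast]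
      conv_lhs => rw [← Rat.num_div_den q]
      rw [inv_div, div_eq_div_iff hq' hn']
      push_cast
      rw [← h5]
      ring)
    have h2 : (q.num.sign * q.den).natAbs ≤ q.den := by
      rw [Int.natAbs_mul, Int.natAbs_sign]
      split_ifs <;> simp
    have h3 := Nat.size_le_size h2
    unfold ratSize at *
    omega

theorem ratSize_div_le (p q : ℚ) : ratSize (p / q) ≤ 2 * (ratSize p + ratSize q) + 2 := by
  rw [div_eq_mul_inv]
  have h1 := ratSize_mul_le p q⁻¹
  have h2 := ratSize_inv q
  omega

theorem ratSize_floor_le (q : ℚ) : ratSize ((⌊q⌋ : ℤ) : ℚ) ≤ ratSize q := by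
  have h1 : (⌊q⌋).natAbs ≤ q.num.natAbs := by
    rw [Rat.floor_def']
    exact Int.natAbs_ediv_le_natAbs q.num q.den
  have h2 := Nat.size_le_size h1
  have h3 : 1 ≤ q.den.size := Nat.size_pos.mpr q.den_pos
  simp only [ratSize, Rat.num_intCast, Rat.den_intCast, Nat.size_one] at *
  omega

/-! ## Time bounds for programs -/

/-- All memory cells have bit length at most `Z`. -/
def Small (Z : ℕ) (σ : Mem) : Prop := ∀ a i, ratSize (σ a i) ≤ Z

/-- The value of `e` has at most `e.sizeFactor * Z` bits if all cells have at most `Z` bits. -/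
def Expr.sizeFactor : Expr → ℕ
  | .lit q => ratSize q
  | .read _ _ => 1
  | .add e f => 2 * (e.sizeFactor + f.sizeFactor)
  | .sub e f => 2 * (e.sizeFactor + f.sizeFactor)
  | .mul e f => 2 * (e.sizeFactor + f.sizeFactor)
  | .div e f => 2 * (e.sizeFactor + f.sizeFactor) + 2
  | .floor e => e.sizeFactor
  | .le _ _ => 3

/-- Evaluating `e` costs at most `e.costFactor * Z` if all cells have at most `Z` bits. -/
def Expr.costFactor : Expr → ℕ
  | .lit q => ratSize q + 1
  | .read _ i => i.costFactor + 2
  | .add e f => e.costFactor + f.costFactor + (Expr.add e f).sizeFactor + 1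
  | .sub e f => e.costFactor + f.costFactor + (Expr.sub e f).sizeFactor + 1
  | .mul e f => e.costFactor + f.costFactor + (Expr.mul e f).sizeFactor + 1
  | .div e f => e.costFactor + f.costFactor + (Expr.div e f).sizeFactor + 1
  | .floor e => e.costFactor + e.sizeFactor + 1
  | .le e f => e.costFactor + f.costFactor + 4

theorem ratSize_eval_le {Z : ℕ} (hZ : 1 ≤ Z) {σ : Mem} (hσ : Small Z σ) (e : Expr) :
    ratSize (e.eval σ) ≤ e.sizeFactor * Z := by
  induction e with
  | lit q => exact Nat.le_mul_of_pos_right _ hZ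
  | read a i _ =>
    rw [Expr.sizeFactor, one_mul]
    exact hσ a _
  | add e f he hf =>
    refine (ratSize_add_le _ _).trans ?_
    rw [Expr.sizeFactor, mul_assoc, add_mul]
    omega
  | sub e f he hf =>
    refine (ratSize_sub_le _ _).trans ?_
    rw [Expr.sizeFactor, mul_assoc, add_mul]
    omega
  | mul e f he hf =>
    refine (ratSize_mul_le _ _).trans ?_
    rw [Expr.sizeFactor, mul_assoc, add_mul]
    omega
  | div e f he hf =>
    refine (ratSize_div_le _ _).trans ?_
    rw [Expr.sizeFactor, add_mul, mul_assoc, add_mul]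
    omega
  | floor e he => exact (ratSize_floor_le _).trans he
  | le e f _ _ =>
    have : ratSize ((Expr.le e f).eval σ) ≤ 3 := by
      unfold Expr.eval
      split_ifs <;> simp [ratSize]
    rw [Expr.sizeFactor]
    omega

theorem cost_le {Z : ℕ} (hZ : 1 ≤ Z) {σ : Mem} (hσ : Small Z σ) (e : Expr) :
    e.cost σ ≤ e.costFactor * Z := by
  induction e with
  | lit q => exact Nat.le_mul_of_pos_right _ hZ
  | read a i hi =>
    have := ratSize_eval_le hZ hσ (.read a i)
    simp only [Expr.cost, Expr.costFactor, Expr.sizeFactor, add_mul] at *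
    omega
  | add e f he hf =>
    have := ratSize_eval_le hZ hσ (.add e f)
    simp only [Expr.cost, Expr.costFactor, add_mul] at *
    omega
  | sub e f he hf =>
    have := ratSize_eval_le hZ hσ (.sub e f)
    simp only [Expr.cost, Expr.costFactor, add_mul] at *
    omega
  | mul e f he hf =>
    have := ratSize_eval_le hZ hσ (.mul e f)
    simp only [Expr.cost, Expr.costFactor, add_mul] at *
    omega
  | div e f he hf =>
    have := ratSize_eval_le hZ hσ (.div e f)
    simp only [Expr.cost, Expr.costFactor, add_mul] at *
    omega
  | floor e he =>
    have := ratSize_eval_le hZ hσ (.floor e)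
    simp only [Expr.cost, Expr.costFactor, Expr.sizeFactor, add_mul] at *
    omega
  | le e f he hf =>
    have := ratSize_eval_le hZ hσ (.le e f)
    simp only [Expr.cost, Expr.costFactor, Expr.sizeFactor, add_mul] at *
    omega

/-- A bound for the cost of a program whose cells always have at most `X` bits and whose loops are
iterated at most `X` times. -/
noncomputable def Prog.timeBound : Prog → Polynomial ℕ
  | .skip => 1
  | .store _ i e => ((i.costFactor + e.costFactor : ℕ) : Polynomial ℕ) * Polynomial.X + 1
  | .seq p q => p.timeBound + q.timeBound + 1
  | .ite b p q => ((b.costFactor : ℕ) : Polynomial ℕ) * Polynomial.X + p.timeBound + q.timeBound + 1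
  | .loop b p => (Polynomial.X + 1) *
      (((b.costFactor : ℕ) : Polynomial ℕ) * Polynomial.X + p.timeBound + 1)

/-- Started in `σ`, the program `p` halts within its time bound in a small memory
satisfying `Q`. -/
def Runs (Z : ℕ) (p : Prog) (σ : Mem) (Q : Mem → Prop) : Prop :=
  ∃ σ' k, Exec p σ σ' k ∧ k ≤ p.timeBound.eval Z ∧ Small Z σ' ∧ Q σ'

theorem Runs.seq {Z : ℕ} {p q : Prog} {σ : Mem} {Q R : Mem → Prop} (hp : Runs Z p σ Q)
    (hq : ∀ σ', Small Z σ' → Q σ' → Runs Z q σ' R) : Runs Z (.seq p q) σ R := by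
  obtain ⟨σ', k, hk, hkle, hs, hQ⟩ := hp
  obtain ⟨σ'', l, hl, hlle, hs', hR⟩ := hq σ' hs hQ
  refine ⟨σ'', _, Exec.seq hk hl, ?_, hs', hR⟩
  simp only [Prog.timeBound, Polynomial.eval_add, Polynomial.eval_one]
  omega

theorem Small.update {Z : ℕ} {σ : Mem} (hσ : Small Z σ) (a i : ℕ) {q : ℚ} (hq : ratSize q ≤ Z) :
    Small Z (Function.update σ a (Function.update (σ a) i q)) := by
  intro a' i'
  simp only [Function.update_apply]
  split_ifs
  · rw [Function.update_apply]
    split_ifs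
    · exact hq
    · exact hσ _ _
  · exact hσ _ _

theorem runs_store {Z : ℕ} (hZ : 1 ≤ Z) {σ : Mem} (hσ : Small Z σ) (a : ℕ) {i e : Expr} {k : ℕ}
    {q : ℚ} (hi : i.eval σ = k) (he : e.eval σ = q) (hq : ratSize q ≤ Z) :
    Runs Z (.store a i e) σ fun σ' =>
      σ' = Function.update σ a (Function.update (σ a) k q) := by
  refine ⟨_, _, Exec.store σ a i e, ?_, ?_, ?_⟩
  · have h1 := cost_le hZ hσ i
    have h2 := cost_le hZ hσ e
    simp only [Prog.timeBound, Polynomial.eval_add, Polynomial.eval_mul, Polynomial.eval_natCast,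
      Polynomial.eval_X, Polynomial.eval_one, Nat.cast_id, add_mul]
    omega
  · rw [he]
    exact hσ.update _ _ hq
  · rw [hi, he, Nat.floor_natCast]

theorem runs_loop {Z M : ℕ} (hZ : 1 ≤ Z) (hM : M ≤ Z) {b : Expr} {p : Prog} {Inv : ℕ → Mem → Prop}
    (hstep : ∀ j < M, ∀ σ, Small Z σ → Inv j σ → b.eval σ ≠ 0 ∧ Runs Z p σ (Inv (j + 1)))
    (hfinal : ∀ σ, Small Z σ → Inv M σ → b.eval σ = 0) {σ : Mem} (hσ : Small Z σ) (h0 : Inv 0 σ) :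
    Runs Z (.loop b p) σ (Inv M) := by
  have key : ∀ d ≤ M, ∀ σ, Small Z σ → Inv (M - d) σ → ∃ σ' k, Exec (.loop b p) σ σ' k ∧
      k ≤ (d + 1) * (b.costFactor * Z + p.timeBound.eval Z + 1) ∧ Small Z σ' ∧ Inv M σ' := by
    intro d
    induction d with
    | zero =>
      intro _ σ hσ hI
      have := cost_le hZ hσ b
      exact ⟨σ, _, Exec.loop_stop (hfinal σ hσ hI), by linarith, hσ, hI⟩
    | succ d ih =>
      intro hd σ hσ hI
      obtain ⟨hb, σ', k, hk, hkle, hs, hI'⟩ := hstep (M - (d + 1)) (by omega) σ hσ hI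
      rw [show M - (d + 1) + 1 = M - d by omega] at hI'
      obtain ⟨σ'', l, hl, hlle, hs', hI''⟩ := ih (by omega) σ' hs hI'
      have := cost_le hZ hσ b
      refine ⟨σ'', _, Exec.loop_step hb hk hl, ?_, hs', hI''⟩
      rw [add_mul _ 1]
      omega
  obtain ⟨σ', k, hk, hkle, h⟩ := key M le_rfl σ hσ (by rwa [Nat.sub_self])
  refine ⟨σ', k, hk, hkle.trans ?_, h⟩
  simp only [Prog.timeBound, Polynomial.eval_add, Polynomial.eval_mul, Polynomial.eval_natCast,
    Polynomial.eval_X, Polynomial.eval_one, Nat.cast_id]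
  exact Nat.mul_le_mul_right _ (by omega)

/-! ## Filling an array -/

/-- The loop counter. -/
def Expr.ctr : Expr := .read 7 (.lit 0)

/-- Fill `bound` cells of array `a` from cell `off` on with the values of `e`. -/
def fill (a : ℕ) (off bound e : Expr) : Prog :=
  .seq (.store 7 (.lit 0) (.lit 0))
    (.loop (.le (.add .ctr (.lit 1)) bound)
      (.seq (.store a (.add .ctr off) e) (.store 7 (.lit 0) (.add .ctr (.lit 1)))))

/-- `σ'` differs from `σ` at most in array `a` and in the loop counter. -/
def Frame (a : ℕ) (σ σ' : Mem) : Prop := ∀ a', a' ≠ a → a' ≠ 7 → σ' a' = σ a'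

theorem runs_fill {Z a o M : ℕ} {off bound e : Expr} {F : ℕ → ℚ} {σ : Mem} (hσ : Small Z σ)
    (ha : a ≠ 7) (hM : M + 3 ≤ Z) (h0 : ∀ i < o, σ a i = F i)
    (hoff : ∀ σ', Frame a σ σ' → off.eval σ' = o)
    (hbound : ∀ σ', Frame a σ σ' → bound.eval σ' = M)
    (he : ∀ σ' j, Frame a σ σ' → Expr.ctr.eval σ' = (j : ℕ) → j < M →
      (∀ i < o + j, σ' a i = F i) → e.eval σ' = F (o + j))
    (hF : ∀ j < M, ratSize (F (o + j)) ≤ Z) :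
    Runs Z (fill a off bound e) σ fun σ' => Frame a σ σ' ∧ ∀ i < o + M, σ' a i = F i := by
  have hZ : 1 ≤ Z := by omega
  have hctr : ∀ σ' : Mem, Expr.ctr.eval σ' = σ' 7 0 := by
    intro σ'
    simp [Expr.ctr, Expr.eval]
  have hsucc : ∀ (σ' : Mem) (j : ℕ), Expr.ctr.eval σ' = j →
      (Expr.add .ctr (.lit 1)).eval σ' = ((j + 1 : ℕ) : ℚ) := by
    intro σ' j h
    rw [Expr.eval, h, Expr.eval]
    push_cast
    ring
  have hsize0 : ratSize (0 : ℚ) ≤ Z := by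
    have := ratSize_natCast_le 0
    push_cast at this
    omega
  have hl : ∀ σ' : Mem, (Expr.lit 0).eval σ' = ((0 : ℕ) : ℚ) := fun σ' => by simp [Expr.eval]
  refine (runs_store hZ hσ 7 (k := 0) (q := 0) (hl σ) rfl hsize0).seq fun σ₁ hσ₁ h₁ => ?_
  let Inv : ℕ → Mem → Prop := fun j σ' =>
    Frame a σ σ' ∧ Expr.ctr.eval σ' = (j : ℕ) ∧ ∀ i < o + j, σ' a i = F i
  have hInv : Runs Z (.loop (.le (.add .ctr (.lit 1)) bound)
      (.seq (.store a (.add .ctr off) e) (.store 7 (.lit 0) (.add .ctr (.lit 1))))) σ₁ (Inv M) := by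
    refine runs_loop hZ (by omega) ?_ ?_ hσ₁ ?_
    · rintro j hj σ' hσ' ⟨hfr, hc, hv⟩
      have hs := hsucc σ' j hc
      refine ⟨?_, ?_⟩
      · rw [Expr.eval, hs, hbound σ' hfr, if_pos (by exact_mod_cast hj)]
        exact one_ne_zero
      have hidx : (Expr.add .ctr off).eval σ' = ((o + j : ℕ) : ℚ) := by
        rw [Expr.eval, hc, hoff σ' hfr]
        push_cast
        ring
      refine (runs_store hZ hσ' a hidx (he σ' j hfr hc hj hv) (hF j hj)).seq fun σ₂ hσ₂ h₂ => ?_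
      have hfr₂ : Frame a σ σ₂ := by
        intro a' h h'
        rw [h₂, Function.update_of_ne h, hfr a' h h']
      have hc₂ : Expr.ctr.eval σ₂ = (j : ℕ) := by
        rw [hctr, h₂, Function.update_of_ne ha.symm, ← hctr σ', hc]
      have hsz : ratSize ((j + 1 : ℕ) : ℚ) ≤ Z := (ratSize_natCast_le _).trans (by omega)
      obtain ⟨σ₃, k, hk, hkle, hσ₃, h₃⟩ :=
        runs_store hZ hσ₂ 7 (k := 0) (hl σ₂) (hsucc σ₂ j hc₂) hsz
      refine ⟨σ₃, k, hk, hkle, hσ₃, ?_, ?_, ?_⟩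
      · intro a' h h'
        rw [h₃, Function.update_of_ne h', hfr₂ a' h h']
      · rw [hctr, h₃]
        simp
      · intro i hi
        rw [h₃, Function.update_of_ne ha, h₂, Function.update_self, Function.update_apply]
        split_ifs with hio
        · rw [hio]
        · exact hv i (by omega)
    · rintro σ' hσ' ⟨hfr, hc, -⟩
      rw [Expr.eval, hsucc σ' M hc, hbound σ' hfr, if_neg]
      push_cast
      linarith
    · refine ⟨?_, ?_, ?_⟩
      · intro a' h h'
        rw [h₁, Function.update_of_ne h']
      · rw [hctr, h₁]
        simp
      · intro i hi
        rw [h₁, Function.update_of_ne ha]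
        exact h0 i (by omega)
  obtain ⟨σ', k, hk, hkle, hs, hfr, -, hv⟩ := hInv
  exact ⟨σ', k, hk, hkle, hs, hfr, hv⟩

/-! ## The knapsack table -/

section Table

variable (v : ℕ → ℕ) (w : ℕ → ℚ) (inf : ℚ)

/-- The least weight of a subset of the first `k` items of total value exactly `u`
(or `inf` if there is none). -/
def minWeight : ℕ → ℕ → ℚ
  | 0, u => if u = 0 then 0 else inf
  | k + 1, u => if v k ≤ u ∧ minWeight k (u - v k) + w k ≤ minWeight k u
      then minWeight k (u - v k) + w k else minWeight k u

/-- The binary code of a subset attaining `minWeight`. -/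
def minWeightCode : ℕ → ℕ → ℕ
  | 0, _ => 0
  | k + 1, u => if v k ≤ u ∧ minWeight v w inf k (u - v k) + w k ≤ minWeight v w inf k u
      then minWeightCode k (u - v k) + 2 ^ k else minWeightCode k u

/-- The set of the positions of the binary digits `1`. -/
def codedSet (n m : ℕ) : Finset ℕ := (Finset.range n).filter fun i => m.testBit i = true

variable {v w inf}

theorem minWeight_nonneg (hw : ∀ i, 0 ≤ w i) (hinf : 0 ≤ inf) (k u : ℕ) :
    0 ≤ minWeight v w inf k u := by
  induction k generalizing u with
  | zero =>
    unfold minWeight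
    split_ifs
    · exact le_rfl
    · exact hinf
  | succ k ih =>
    unfold minWeight
    split_ifs
    · exact add_nonneg (ih _) (hw k)
    · exact ih _

theorem minWeight_le (hinf : 0 ≤ inf) (k u : ℕ) : minWeight v w inf k u ≤ inf := by
  induction k generalizing u with
  | zero =>
    unfold minWeight
    split_ifs
    · exact hinf
    · exact le_rfl
  | succ k ih =>
    unfold minWeight
    split_ifs with h
    · exact h.2.trans (ih _)
    · exact ih _

theorem minWeight_mem {S : AddSubgroup ℚ} (hw : ∀ i, w i ∈ S) (hinf : inf ∈ S) (k u : ℕ) :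
    minWeight v w inf k u ∈ S := by
  induction k generalizing u with
  | zero =>
    unfold minWeight
    split_ifs
    · exact S.zero_mem
    · exact hinf
  | succ k ih =>
    unfold minWeight
    split_ifs
    · exact S.add_mem (ih _) (hw k)
    · exact ih _

theorem minWeightCode_lt (k u : ℕ) : minWeightCode v w inf k u < 2 ^ k := by
  induction k generalizing u with
  | zero => simp [minWeightCode]
  | succ k ih =>
    unfold minWeightCode
    rw [pow_succ]
    split_ifs
    · have := ih (u - v k)
      omega
    · have := ih u
      omega

theorem minWeight_le_sum (k : ℕ) (x : Finset ℕ) (hx : x ⊆ Finset.range k) :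
    minWeight v w inf k (∑ i ∈ x, v i) ≤ ∑ i ∈ x, w i := by
  induction k generalizing x with
  | zero =>
    have : x = ∅ := by simpa using hx
    simp [this, minWeight]
  | succ k ih =>
    by_cases hk : k ∈ x
    · have hsub : x.erase k ⊆ Finset.range k := fun i hi => by
        have h1 := Finset.mem_range.mp (hx (Finset.mem_of_mem_erase hi))
        have h2 := Finset.ne_of_mem_erase hi
        exact Finset.mem_range.mpr (by omega)
      have hv := Finset.add_sum_erase x v hk
      have hw' := Finset.add_sum_erase x w hk
      have h1 : minWeight v w inf k (∑ i ∈ x, v i - v k) + w k ≤ ∑ i ∈ x, w i := by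
        rw [← hv, Nat.add_sub_cancel_left, ← hw']
        linarith [ih _ hsub]
      unfold minWeight
      split_ifs with h
      · exact h1
      · have : v k ≤ ∑ i ∈ x, v i := by omega
        have h2 : minWeight v w inf k (∑ i ∈ x, v i) <
            minWeight v w inf k (∑ i ∈ x, v i - v k) + w k := by
          by_contra hcon
          exact h ⟨this, not_lt.mp hcon⟩
        linarith
    · have hsub : x ⊆ Finset.range k := fun i hi => by
        have h1 := Finset.mem_range.mp (hx hi)
        have h2 : i ≠ k := fun e => hk (e ▸ hi)
        exact Finset.mem_range.mpr (by omega)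
      unfold minWeight
      split_ifs with h
      · exact h.2.trans (ih x hsub)
      · exact ih x hsub

theorem codedSet_succ_of_lt {k m : ℕ} (hm : m < 2 ^ k) : codedSet (k + 1) m = codedSet k m := by
  unfold codedSet
  rw [Finset.range_add_one, Finset.filter_insert, if_neg]
  simp [Nat.testBit_lt_two_pow hm]

theorem codedSet_add_two_pow {k m : ℕ} (hm : m < 2 ^ k) :
    codedSet (k + 1) (m + 2 ^ k) = insert k (codedSet k m) := by
  unfold codedSet
  rw [Finset.range_add_one, Finset.filter_insert, if_pos]
  · congr 1
    refine Finset.filter_congr fun i hi => ?_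
    rw [add_comm, Nat.testBit_two_pow_add_gt (Finset.mem_range.mp hi)]
  · rw [add_comm, Nat.testBit_two_pow_add_eq, Nat.testBit_lt_two_pow hm]
    rfl

theorem notMem_codedSet (k m : ℕ) : k ∉ codedSet k m := by simp [codedSet]

/-- Where `minWeight` is not `inf`, it is attained. -/
theorem sum_codedSet (hw : ∀ i, 0 ≤ w i) (k u : ℕ) (h : minWeight v w inf k u < inf) :
    ∑ i ∈ codedSet k (minWeightCode v w inf k u), v i = u ∧
      ∑ i ∈ codedSet k (minWeightCode v w inf k u), w i = minWeight v w inf k u := by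
  induction k generalizing u with
  | zero =>
    unfold minWeight at h ⊢
    split_ifs at h ⊢ with h0
    · simp [codedSet, h0]
    · exact absurd h (lt_irrefl _)
  | succ k ih =>
    have hlt := fun u => minWeightCode_lt (v := v) (w := w) (inf := inf) k u
    unfold minWeight at h
    unfold minWeight minWeightCode
    split_ifs at h ⊢ with hc
    · obtain ⟨h1, h2⟩ := ih (u - v k) (by linarith [hw k])
      rw [codedSet_add_two_pow (hlt _), Finset.sum_insert (notMem_codedSet _ _),
        Finset.sum_insert (notMem_codedSet _ _), h1, h2]
      exact ⟨by omega, add_comm _ _⟩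
    · rw [codedSet_succ_of_lt (hlt _)]
      exact ih u h

end Table

/-- The best index below `j` among those satisfying `ok` (and `0`). -/
def bestIndex (ok : ℕ → Prop) [DecidablePred ok] (obj : ℕ → ℚ) : ℕ → ℕ
  | 0 => 0
  | j + 1 => if ok j ∧ obj (bestIndex ok obj j) ≤ obj j then j else bestIndex ok obj j

theorem bestIndex_le (ok : ℕ → Prop) [DecidablePred ok] (obj : ℕ → ℚ) (j : ℕ) :
    bestIndex ok obj j ≤ j - 1 := by
  induction j with
  | zero => simp [bestIndex]
  | succ j ih =>
    unfold bestIndex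
    split_ifs <;> omega

theorem bestIndex_ok {ok : ℕ → Prop} [DecidablePred ok] (h0 : ok 0) (obj : ℕ → ℚ) (j : ℕ) :
    ok (bestIndex ok obj j) := by
  induction j with
  | zero => exact h0
  | succ j ih =>
    unfold bestIndex
    split_ifs with h
    · exact h.1
    · exact ih

theorem le_bestIndex (ok : ℕ → Prop) [DecidablePred ok] (obj : ℕ → ℚ) (j : ℕ) :
    ∀ i < j, ok i → obj i ≤ obj (bestIndex ok obj j) := by
  induction j with
  | zero => intro i hi; omega
  | succ j ih =>
    intro i hi hok
    unfold bestIndex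
    rcases Nat.lt_succ_iff_lt_or_eq.mp hi with hi | rfl
    · split_ifs with h
      · exact (ih i hi hok).trans h.2
      · exact ih i hi hok
    · split_ifs with h
      · exact le_rfl
      · exact (not_le.mp fun h' => h ⟨hok, h'⟩).le

/-- The table yields an optimal set for `G * (value) - pen (weight)`. -/
theorem codedSet_optimal {n V : ℕ} {v : ℕ → ℕ} {w : ℕ → ℚ} {inf G : ℚ} {pen : ℚ → ℚ}
    (hw : ∀ i, 0 ≤ w i) (hinf : ∑ i ∈ Finset.range n, w i < inf)
    (hV : ∑ i ∈ Finset.range n, v i < V) (hpen : Monotone pen) (x : Finset ℕ)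
    (hx : x ⊆ Finset.range n) :
    let u := bestIndex (fun u => minWeight v w inf n u ≤ ∑ i ∈ Finset.range n, w i)
      (fun u => G * u - pen (minWeight v w inf n u)) V
    let z := codedSet n (minWeightCode v w inf n u)
    G * (∑ i ∈ x, v i : ℕ) - pen (∑ i ∈ x, w i) ≤
      G * (∑ i ∈ z, v i : ℕ) - pen (∑ i ∈ z, w i) := by
  intro u z
  have h0 : minWeight v w inf n 0 ≤ ∑ i ∈ Finset.range n, w i := by
    have := minWeight_le_sum (v := v) (w := w) (inf := inf) n ∅ (Finset.empty_subset _)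
    rw [Finset.sum_empty, Finset.sum_empty] at this
    exact this.trans (Finset.sum_nonneg fun i _ => hw i)
  have hu : minWeight v w inf n u ≤ ∑ i ∈ Finset.range n, w i :=
    bestIndex_ok (ok := fun u => minWeight v w inf n u ≤ ∑ i ∈ Finset.range n, w i) h0 _ V
  obtain ⟨h1, h2⟩ := sum_codedSet hw n u (hu.trans_lt hinf)
  have h3 := minWeight_le_sum (v := v) (w := w) (inf := inf) n x hx
  have h4 : ∑ i ∈ x, v i < V := (Finset.sum_le_sum_of_subset hx).trans_lt hV
  have h5 : ∑ i ∈ x, w i ≤ ∑ i ∈ Finset.range n, w i :=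
    Finset.sum_le_sum_of_subset_of_nonneg hx fun i _ _ => hw i
  have h6 := le_bestIndex (fun u => minWeight v w inf n u ≤ ∑ i ∈ Finset.range n, w i)
    (fun u => G * u - pen (minWeight v w inf n u)) V _ h4 (h3.trans h5)
  rw [h1, h2]
  refine le_trans ?_ h6
  have := hpen h3
  linarith

/-! ## Bit lengths of the numbers that occur -/

theorem abs_le_two_pow_ratSize (q : ℚ) : |q| ≤ 2 ^ ratSize q := by
  have h1 : |q| ≤ (q.num.natAbs : ℚ) := by
    conv_lhs => rw [← Rat.num_div_den q]
    rw [abs_div, Nat.abs_cast, ← Int.cast_abs, Int.abs_eq_natAbs, Int.cast_natCast]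
    exact div_le_self (Nat.cast_nonneg _) (by exact_mod_cast q.den_pos)
  refine h1.trans ?_
  have h2 : q.num.natAbs ≤ 2 ^ ratSize q :=
    q.num.natAbs.lt_size_self.le.trans (Nat.pow_le_pow_right two_pos (by unfold ratSize; omega))
  exact_mod_cast h2

theorem one_le_ratSize (q : ℚ) : 1 ≤ ratSize q := by
  unfold ratSize
  omega

/-- The rationals with denominator `D`. -/
def fractions (D : ℕ) : AddSubgroup ℚ := AddSubgroup.zmultiples (D : ℚ)⁻¹

theorem mem_fractions {D : ℕ} {q : ℚ} : q ∈ fractions D ↔ ∃ a : ℤ, q = a / D := by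
  unfold fractions
  rw [AddSubgroup.mem_zmultiples_iff]
  constructor
  · rintro ⟨a, rfl⟩
    exact ⟨a, by rw [zsmul_eq_mul, div_eq_mul_inv]⟩
  · rintro ⟨a, rfl⟩
    exact ⟨a, by rw [zsmul_eq_mul, div_eq_mul_inv]⟩

theorem mem_fractions_of_den_dvd {D : ℕ} (hD : D ≠ 0) {q : ℚ} (h : q.den ∣ D) :
    q ∈ fractions D := by
  obtain ⟨d, rfl⟩ := h
  have h1 : (q.den : ℚ) ≠ 0 := by exact_mod_cast q.den_nz
  have h2 : (d : ℚ) ≠ 0 := by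
    intro h0
    apply hD
    rw [show d = 0 by exact_mod_cast h0, mul_zero]
  rw [mem_fractions]
  refine ⟨q.num * d, ?_⟩
  conv_lhs => rw [← Rat.num_div_den q]
  push_cast
  field_simp

theorem mul_mem_fractions {D E : ℕ} {p q : ℚ} (hp : p ∈ fractions D) (hq : q ∈ fractions E) :
    p * q ∈ fractions (D * E) := by
  rw [mem_fractions] at *
  obtain ⟨a, rfl⟩ := hp
  obtain ⟨b, rfl⟩ := hq
  exact ⟨a * b, by push_cast; rw [div_mul_div_comm]⟩

theorem intCast_mem_fractions {D : ℕ} (hD : D ≠ 0) (a : ℤ) : (a : ℚ) ∈ fractions D := by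
  rw [mem_fractions]
  have : (D : ℚ) ≠ 0 := by exact_mod_cast hD
  exact ⟨a * D, by push_cast; field_simp⟩

theorem ratSize_le_of_mem_fractions {D B : ℕ} (hD : D ≠ 0) {q : ℚ} (hq : q ∈ fractions D)
    (hB : |q| ≤ 2 ^ B) : ratSize q ≤ B + 2 * D.size + 1 := by
  obtain ⟨a, ha⟩ := mem_fractions.mp hq
  have h := ratSize_le_of_eq_div hD ha
  have hD' : (0 : ℚ) < D := by exact_mod_cast Nat.pos_of_ne_zero hD
  have h1 : a.natAbs.size ≤ B + D.size := by
    rw [Nat.size_le, pow_add]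
    have h2 : (a.natAbs : ℚ) = |q| * D := by
      rw [ha, abs_div, Nat.abs_cast, div_mul_cancel₀ _ hD'.ne', ← Int.cast_abs,
        Int.abs_eq_natAbs, Int.cast_natCast]
    have h3 : (a.natAbs : ℚ) ≤ ((2 ^ B * D : ℕ) : ℚ) := by
      rw [h2]
      push_cast
      exact mul_le_mul_of_nonneg_right hB hD'.le
    have h4 : a.natAbs ≤ 2 ^ B * D := by exact_mod_cast h3
    exact h4.trans_lt (Nat.mul_lt_mul_of_pos_left D.lt_size_self (by positivity))
  omega

/-- All rational numbers in the input. -/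
def inputs (I : Inst) (h : List (State I)) : List ℚ :=
  (List.ofFn I.w ++ [I.c, I.P]) ++ h.flatMap fun y => List.ofFn y.profit ++ [y.B]

theorem sum_ratSize_inputs (I : Inst) (h : List (State I)) :
    ((inputs I h).map ratSize).sum = inputSize I h := by
  have key : ∀ h : List (State I),
      ((h.flatMap fun y => List.ofFn y.profit ++ [y.B]).map ratSize).sum =
        (h.map State.size).sum := by
    intro h
    induction h with
    | nil => rfl
    | cons y h ih =>
      rw [List.flatMap_cons, List.map_append, List.sum_append, ih, List.map_cons, List.sum_cons]
      simp [State.size, List.map_ofFn, List.sum_ofFn]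
  unfold inputs inputSize
  rw [List.map_append, List.sum_append, key]
  simp [Inst.size, List.map_ofFn, List.sum_ofFn, add_assoc]

theorem ratSize_le_inputSize {I : Inst} {h : List (State I)} {q : ℚ} (hq : q ∈ inputs I h) :
    ratSize q ≤ inputSize I h := by
  rw [← sum_ratSize_inputs]
  exact List.single_le_sum (fun _ _ => Nat.zero_le _) _ (List.mem_map_of_mem hq)

/-- A common denominator of all rational numbers in the input. -/
def commonDen (I : Inst) (h : List (State I)) : ℕ := ((inputs I h).map Rat.den).prod

theorem commonDen_ne_zero (I : Inst) (h : List (State I)) : commonDen I h ≠ 0 := by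
  refine List.prod_ne_zero fun h0 => ?_
  obtain ⟨q, -, hq⟩ := List.mem_map.mp h0
  exact q.den_nz hq

theorem natSize_commonDen_le (I : Inst) (h : List (State I)) :
    (commonDen I h).size ≤ inputSize I h + 1 := by
  rw [← sum_ratSize_inputs]
  unfold commonDen
  induction inputs I h with
  | nil => simp
  | cons q l ih =>
    rw [List.map_cons, List.prod_cons, List.map_cons, List.sum_cons]
    have h1 := natSize_mul_le q.den (l.map Rat.den).prod
    have h2 : q.den.size ≤ ratSize q := by
      unfold ratSize
      omega
    omega

theorem mem_fractions_commonDen {I : Inst} {h : List (State I)} {q : ℚ} (hq : q ∈ inputs I h) :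
    q ∈ fractions (commonDen I h) :=
  mem_fractions_of_den_dvd (commonDen_ne_zero I h) (List.dvd_prod (List.mem_map_of_mem hq))

theorem weight_mem_inputs {I : Inst} (h : List (State I)) (i : Fin I.n) : I.w i ∈ inputs I h := by
  simp [inputs, List.mem_ofFn]

theorem rate_mem_inputs {I : Inst} (h : List (State I)) : I.c ∈ inputs I h := by
  simp [inputs]

theorem bound_mem_inputs {I : Inst} (h : List (State I)) : I.P ∈ inputs I h := by
  simp [inputs]

theorem profit_mem_inputs {I : Inst} {h : List (State I)} {y : State I} (hy : y ∈ h)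
    (i : Fin I.n) : y.profit i ∈ inputs I h := by
  simp only [inputs, List.mem_append, List.mem_flatMap]
  exact Or.inr ⟨y, hy, Or.inl (List.mem_ofFn.mpr ⟨i, rfl⟩)⟩

theorem capacity_mem_inputs {I : Inst} {h : List (State I)} {y : State I} (hy : y ∈ h) :
    y.B ∈ inputs I h := by
  simp only [inputs, List.mem_append, List.mem_flatMap]
  exact Or.inr ⟨y, hy, Or.inr (List.mem_singleton.mpr rfl)⟩

theorem card_le_inputSize (I : Inst) (h : List (State I)) : I.n + 1 ≤ inputSize I h := by
  have h1 : ∑ _i : Fin I.n, 1 ≤ ∑ i, ratSize (I.w i) :=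
    Finset.sum_le_sum fun i _ => one_le_ratSize _
  have h2 := one_le_ratSize I.c
  simp only [Finset.sum_const, Finset.card_univ, Fintype.card_fin, smul_eq_mul, mul_one] at h1
  unfold inputSize Inst.size
  omega

theorem length_le_inputSize (I : Inst) (h : List (State I)) : h.length + 1 ≤ inputSize I h := by
  have h1 : h.length ≤ (h.map State.size).sum := by
    induction h with
    | nil => simp
    | cons y h ih =>
      have := one_le_ratSize y.B
      rw [List.length_cons, List.map_cons, List.sum_cons, State.size]
      omega
  have h2 := one_le_ratSize I.c
  unfold inputSize Inst.size
  omega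

/-! ## The program -/

section Exprs

/-- `if c then e else f`. -/
def Expr.cond (c e f : Expr) : Expr := .add f (.mul c (.sub e f))

def Expr.items : Expr := .read 0 (.lit 0)
def Expr.rounds : Expr := .read 0 (.lit 1)
def Expr.rate : Expr := .read 0 (.lit 2)

/-- The total weight of all items, from the table of partial sums in array `8`. -/
def Expr.weight : Expr := .read 8 .items

/-- The diameter of the payoff function. -/
def Expr.range : Expr := .add (.mul .items (.read 0 (.lit 3))) (.mul .rate .weight)

/-- The number of random bits per item. -/
def Expr.bits : Expr := .read 10 .rounds

/-- The number of columns of the knapsack table. -/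
def Expr.width : Expr := .add (.read 14 .items) (.lit 1)

/-- The row of the table cell given by the loop counter. -/
def Expr.row : Expr := .floor (.div .ctr .width)

/-- The column of the table cell given by the loop counter. -/
def Expr.col : Expr := .sub .ctr (.mul .row .width)

/-- The cell of the table from which item `k` is added to obtain the value in cell `i`. -/
def Expr.source (i k : Expr) : Expr := .sub i (.read 13 k)

/-- Whether item `k` is added to obtain the value in cell `i`, which lies in column `u`. -/
def Expr.take (i k u : Expr) : Expr :=
  .mul (.le (.read 13 k) u)
    (.le (.add (.read 15 (.source i k)) (.read 1 k)) (.read 15 i))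

/-- The least weight of a set of value `u`. -/
def Expr.minWeight (u : Expr) : Expr := .read 15 (.add (.mul .items .width) u)

/-- The objective of the best set of value `u`. -/
def Expr.objective (u : Expr) : Expr :=
  .sub (.mul .range u) (.read 18 (.add (.mul .rounds .width) u))

/-- The code of the chosen set. -/
def Expr.code : Expr := .read 17 (.add (.mul .items .width) (.read 19 .width))

end Exprs

/-- Array `8` receives the partial sums of the weights. -/
def sumWeights : Prog := fill 8 (.lit 1) .items (.add (.read 8 .ctr) (.read 1 .ctr))

/-- Array `9` receives the numbers `4 ^ j - 1`. -/
def powersOfFour : Prog := fill 9 (.lit 1) .rounds (.add (.mul (.lit 4) (.read 9 .ctr)) (.lit 3))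

/-- Array `10` receives the number of `j` with `4 ^ j ≤ t + 1`. -/
def countBits : Prog :=
  fill 10 (.lit 1) .rounds (.add (.read 10 .ctr) (.le (.read 9 (.add .ctr (.lit 1))) .rounds))

/-- Array `11` receives the partial sums of the profits. -/
def sumProfits : Prog :=
  fill 11 .items (.mul .rounds .items) (.add (.read 11 .ctr) (.read 2 .ctr))

/-- Array `12` receives the random perturbations. -/
def drawNoise : Prog :=
  fill 12 .items (.mul .bits .items) (.add (.mul (.lit 2) (.read 12 .ctr)) (.read 4 .ctr))

/-- Array `13` receives the perturbed rounded profits. -/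
def perturbProfits : Prog :=
  fill 13 (.lit 0) .items
    (.add (.floor (.div (.read 11 (.add (.mul .rounds .items) .ctr)) .range))
      (.read 12 (.add (.mul .bits .items) .ctr)))

/-- Array `14` receives the partial sums of the perturbed rounded profits. -/
def sumValues : Prog := fill 14 (.lit 1) .items (.add (.read 14 .ctr) (.read 13 .ctr))

/-- Array `15` receives the least weights of sets of a given value. -/
def fillWeightTable : Prog :=
  fill 15 (.lit 0) (.mul (.add .items (.lit 1)) .width)
    (.cond (.le .width .ctr)
      (.cond (.take (.sub .ctr .width) (.sub .row (.lit 1)) .col)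
        (.add (.read 15 (.source (.sub .ctr .width) (.sub .row (.lit 1))))
          (.read 1 (.sub .row (.lit 1))))
        (.read 15 (.sub .ctr .width)))
      (.cond (.le .ctr (.lit 0)) (.lit 0) (.add .weight (.lit 1))))

/-- Array `16` receives the numbers `2 ^ j - 1`. -/
def powersOfTwo : Prog := fill 16 (.lit 1) .items (.add (.mul (.lit 2) (.read 16 .ctr)) (.lit 1))

/-- Array `17` receives the codes of the sets of least weight. -/
def fillCodeTable : Prog :=
  fill 17 .width (.mul .items .width)
    (.cond (.take .ctr .row .col)
      (.add (.read 17 (.source .ctr .row)) (.add (.read 16 .row) (.lit 1)))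
      (.read 17 .ctr))

/-- Array `18` receives the cumulative penalties of the sets of least weight. -/
def sumPenalties : Prog :=
  fill 18 .width (.mul .rounds .width)
    (.add (.read 18 .ctr) (.mul .rate
      (.cond (.le (.minWeight .col) (.read 3 .row)) (.lit 0)
        (.sub (.minWeight .col) (.read 3 .row)))))

/-- Array `19` receives the best of the first values. -/
def findBest : Prog :=
  fill 19 (.lit 1) .width
    (.cond (.mul (.le (.minWeight .ctr) .weight)
        (.le (.objective (.read 19 .ctr)) (.objective .ctr)))
      .ctr (.read 19 .ctr))

/-- Array `5` receives the chosen set. -/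
def decode : Prog :=
  fill 5 (.lit 0) .items
    (.sub (.floor (.div .code (.add (.read 16 .ctr) (.lit 1))))
      (.mul (.lit 2) (.floor (.div .code (.mul (.lit 2) (.add (.read 16 .ctr) (.lit 1)))))))

/-- Follow the perturbed leader. -/
def program : Prog :=
  .seq sumWeights <| .seq powersOfFour <| .seq countBits <| .seq sumProfits <| .seq drawNoise <|
  .seq perturbProfits <| .seq sumValues <| .seq fillWeightTable <| .seq powersOfTwo <|
  .seq fillCodeTable <| .seq sumPenalties <| .seq findBest decode

/-! ## The contents of the arrays -/

section Contents

variable (I : Inst) (h : List (State I)) {m : ℕ} (r : Fin m → Bool)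

/-- The weights, continued by `0`. -/
def weightSeq (i : ℕ) : ℚ := if hi : i < I.n then I.w ⟨i, hi⟩ else 0

/-- The total weight plus `1`, which stands for infinity. -/
def infWeight : ℚ := ∑ i ∈ Finset.range I.n, weightSeq I i + 1

variable {I}

/-- The perturbed rounded profits, continued by `0`. -/
def valueSeq (i : ℕ) : ℕ :=
  if hi : i < I.n then profitUnits h ⟨i, hi⟩ + noise r I.n i (noiseBits h.length) else 0

def tableWidth : ℕ := ∑ i ∈ Finset.range I.n, valueSeq h r i + 1

def weightTable (k u : ℕ) : ℚ := minWeight (valueSeq h r) (weightSeq I) (infWeight I) k u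

def codeTable (k u : ℕ) : ℕ := minWeightCode (valueSeq h r) (weightSeq I) (infWeight I) k u

/-- The sum of the first `τ` of the numbers `B` in array `3`, put into the penalty for weight `w`. -/
def penaltySum (w : ℚ) (τ : ℕ) : ℚ :=
  ∑ s ∈ Finset.range τ, I.c * max 0 (w - initMem I h r 3 s)

def bestValue (j : ℕ) : ℕ :=
  bestIndex (fun u => weightTable h r I.n u ≤ ∑ i ∈ Finset.range I.n, weightSeq I i)
    (fun u => payoffRange I * u - penaltySum h r (weightTable h r I.n u) h.length) j

/-- The final contents of the arrays. -/
def contents : ℕ → ℕ → ℚ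
  | 5, i => ((codeTable h r I.n (bestValue h r (tableWidth h r)) / 2 ^ i % 2 : ℕ) : ℚ)
  | 8, j => ∑ i ∈ Finset.range j, weightSeq I i
  | 9, j => 4 ^ j - 1
  | 10, j => (min j (noiseBits h.length) : ℕ)
  | 11, j => ∑ s ∈ Finset.range (j / I.n), initMem I h r 2 (s * I.n + j % I.n)
  | 12, j => noise r I.n (j % I.n) (j / I.n)
  | 13, j => valueSeq h r j
  | 14, j => (∑ i ∈ Finset.range j, valueSeq h r i : ℕ)
  | 15, j => weightTable h r (j / tableWidth h r) (j % tableWidth h r)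
  | 16, j => 2 ^ j - 1
  | 17, j => codeTable h r (j / tableWidth h r) (j % tableWidth h r)
  | 18, j => penaltySum h r (weightTable h r I.n (j % tableWidth h r)) (j / tableWidth h r)
  | 19, j => bestValue h r j
  | _, _ => 0

/-- The number of cells of an array that are filled by the program. -/
def filled : ℕ → ℕ
  | 5 => I.n
  | 8 => I.n + 1
  | 9 => h.length + 1
  | 10 => h.length + 1
  | 11 => (h.length + 1) * I.n
  | 12 => (noiseBits h.length + 1) * I.n
  | 13 => I.n
  | 14 => I.n + 1
  | 15 => (I.n + 1) * tableWidth h r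
  | 16 => I.n + 1
  | 17 => (I.n + 1) * tableWidth h r
  | 18 => (h.length + 1) * tableWidth h r
  | 19 => tableWidth h r + 1
  | _ => 0

/-- The arrays in `S` have been filled, the others (with the possible exceptions of `x` and of the
loop counter) are as in the beginning. -/
def Filled (S : List ℕ) (x : ℕ) (σ : Mem) : Prop :=
  ∀ a, a ≠ 7 → a ≠ x → (a ∈ S → ∀ i < filled h r a, σ a i = contents h r a i) ∧
    (a ∉ S → σ a = initMem I h r a)

variable {h r}

theorem Filled.eval_init {S : List ℕ} {x : ℕ} {σ : Mem} (hσ : Filled h r S x σ) {a : ℕ} {e : Expr}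
    {k : ℕ} (he : e.eval σ = k) (ha : a ≠ 7 := by decide) (hx : a ≠ x := by decide)
    (hS : a ∉ S := by decide) : (Expr.read a e).eval σ = initMem I h r a k := by
  rw [Expr.eval, he, Nat.floor_natCast, (hσ a ha hx).2 hS]

theorem Filled.eval_contents {S : List ℕ} {x : ℕ} {σ : Mem} (hσ : Filled h r S x σ) {a : ℕ}
    {e : Expr} {k : ℕ} (he : e.eval σ = k) (hk : k < filled h r a) (ha : a ≠ 7 := by decide)
    (hx : a ≠ x := by decide) (hS : a ∈ S := by decide) :
    (Expr.read a e).eval σ = contents h r a k := by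
  rw [Expr.eval, he, Nat.floor_natCast, (hσ a ha hx).1 hS k hk]

end Contents

/-! ## The memory stays small -/

section Bounds

variable {I : Inst} {h : List (State I)} {m : ℕ} {r : Fin m → Bool}

/-- A bound for the bit lengths of all cells and the numbers of iterations of all loops. -/
def memBound (N : ℕ) : ℕ := (N + 1) * (2 * N ^ 2 + 1) + 8 * N + 10

theorem noiseBits_le (t : ℕ) : noiseBits t ≤ t := by
  have h1 := four_pow_noiseBits_le t
  have h2 : noiseBits t < 4 ^ noiseBits t := Nat.lt_pow_self (by norm_num)
  omega

theorem noise_noiseBits_le (n i t : ℕ) : noise r n i (noiseBits t) ≤ t := by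
  have h1 := noise_lt r n i (noiseBits t)
  have h2 := four_pow_noiseBits_le t
  have h3 : 2 ^ noiseBits t ≤ 4 ^ noiseBits t := Nat.pow_le_pow_left (by norm_num) _
  omega

theorem bound_le_payoffRange (i : Fin I.n) : I.P ≤ payoffRange I := by
  have h1 : (1 : ℚ) ≤ I.n := by exact_mod_cast i.pos
  have h2 : 0 ≤ I.c * ∑ i, I.w i :=
    mul_nonneg I.c_nonneg (Finset.sum_nonneg fun i _ => I.w_nonneg i)
  unfold payoffRange
  nlinarith [I.P_nonneg]

theorem totalProfit_le (h : List (State I)) (i : Fin I.n) :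
    totalProfit h i ≤ h.length * I.P := by
  induction h with
  | nil => simp [totalProfit]
  | cons y h ih =>
    simp only [totalProfit, List.map_cons, List.sum_cons, List.length_cons] at ih ⊢
    have := y.profit_le i
    push_cast
    linarith

theorem profitUnits_le (h : List (State I)) (i : Fin I.n) : profitUnits h i ≤ h.length := by
  refine Nat.floor_le_of_le (div_le_of_le_mul₀ (payoffRange_nonneg I) (Nat.cast_nonneg _) ?_)
  exact (totalProfit_le h i).trans
    (mul_le_mul_of_nonneg_left (bound_le_payoffRange i) (Nat.cast_nonneg _))

theorem valueSeq_le (i : ℕ) : valueSeq h r i ≤ 2 * h.length := by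
  unfold valueSeq
  split_ifs with hi
  · have h1 := profitUnits_le h ⟨i, hi⟩
    have h2 := noise_noiseBits_le (r := r) I.n i h.length
    omega
  · omega

theorem tableWidth_pos : 0 < tableWidth h r := Nat.succ_pos _

theorem tableWidth_le : tableWidth h r ≤ 2 * inputSize I h ^ 2 + 1 := by
  have h1 : ∑ i ∈ Finset.range I.n, valueSeq h r i ≤ I.n * (2 * h.length) := by
    have := Finset.sum_le_sum fun i (_ : i ∈ Finset.range I.n) => valueSeq_le (h := h) (r := r) i
    simpa using this
  have h2 : I.n * (2 * h.length) ≤ inputSize I h * (2 * inputSize I h) :=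
    Nat.mul_le_mul (by have := card_le_inputSize I h; omega)
      (by have := length_le_inputSize I h; omega)
  unfold tableWidth
  nlinarith

theorem filled_le (a : ℕ) : filled h r a + 3 ≤ memBound (inputSize I h) := by
  have hn := card_le_inputSize I h
  have ht := length_le_inputSize I h
  have hw := tableWidth_le (h := h) (r := r)
  have hJ := noiseBits_le h.length
  have h1 : (I.n + 1) * tableWidth h r ≤ (inputSize I h + 1) * (2 * inputSize I h ^ 2 + 1) :=
    Nat.mul_le_mul (by omega) hw
  have h2 : (h.length + 1) * tableWidth h r ≤ (inputSize I h + 1) * (2 * inputSize I h ^ 2 + 1) :=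
    Nat.mul_le_mul (by omega) hw
  have h3 : inputSize I h ≤ 2 * inputSize I h ^ 2 + 1 := by nlinarith
  have h4 : (h.length + 1) * I.n ≤ (inputSize I h + 1) * (2 * inputSize I h ^ 2 + 1) :=
    Nat.mul_le_mul (by omega) (by omega)
  have h5 : (noiseBits h.length + 1) * I.n ≤
      (inputSize I h + 1) * (2 * inputSize I h ^ 2 + 1) :=
    Nat.mul_le_mul (by omega) (by omega)
  have h6 : tableWidth h r ≤ (h.length + 1) * tableWidth h r := Nat.le_mul_of_pos_left _ (by omega)
  unfold memBound
  unfold filled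
  split <;> omega

theorem weightSeq_nonneg (i : ℕ) : 0 ≤ weightSeq I i := by
  unfold weightSeq
  split_ifs
  · exact I.w_nonneg _
  · exact le_rfl

theorem sum_weightSeq : ∑ i ∈ Finset.range I.n, weightSeq I i = ∑ i, I.w i := by
  rw [Finset.sum_range]
  exact Finset.sum_congr rfl fun i _ => by simp [weightSeq]

theorem sum_weightSeq_nonneg (j : ℕ) : 0 ≤ ∑ i ∈ Finset.range j, weightSeq I i :=
  Finset.sum_nonneg fun i _ => weightSeq_nonneg i

theorem infWeight_pos : 0 < infWeight I := by
  have := sum_weightSeq_nonneg (I := I) I.n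
  unfold infWeight
  linarith

theorem le_two_pow_inputSize {q : ℚ} (hq : q ∈ inputs I h) : q ≤ 2 ^ inputSize I h :=
  (le_abs_self q).trans ((abs_le_two_pow_ratSize q).trans
    (pow_le_pow_right₀ (by norm_num) (ratSize_le_inputSize hq)))

theorem sum_range_le_mul {f : ℕ → ℚ} {b : ℚ} {j N : ℕ} (hf : ∀ i, f i ≤ b) (hb : 0 ≤ b)
    (hj : j ≤ N) : ∑ i ∈ Finset.range j, f i ≤ 2 ^ N * b := by
  have h1 := Finset.sum_le_sum fun i (_ : i ∈ Finset.range j) => hf i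
  rw [Finset.sum_const, Finset.card_range, nsmul_eq_mul] at h1
  have h2 : (j : ℚ) ≤ 2 ^ N := by
    exact_mod_cast hj.trans Nat.lt_two_pow_self.le
  exact h1.trans (mul_le_mul_of_nonneg_right h2 hb)

theorem weightSeq_le (h : List (State I)) (i : ℕ) : weightSeq I i ≤ 2 ^ inputSize I h := by
  unfold weightSeq
  split_ifs
  · exact le_two_pow_inputSize (weight_mem_inputs h _)
  · positivity

theorem weightSeq_mem (h : List (State I)) (i : ℕ) :
    weightSeq I i ∈ fractions (commonDen I h) := by
  unfold weightSeq
  split_ifs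
  · exact mem_fractions_commonDen (weight_mem_inputs h _)
  · exact zero_mem _

theorem sum_weightSeq_le (h : List (State I)) {j : ℕ} (hj : j ≤ I.n) :
    ∑ i ∈ Finset.range j, weightSeq I i ≤ 2 ^ (2 * inputSize I h) := by
  rw [two_mul, pow_add]
  exact sum_range_le_mul (weightSeq_le h) (by positivity)
    (by have := card_le_inputSize I h; omega)

theorem infWeight_le (h : List (State I)) : infWeight I ≤ 2 ^ (2 * inputSize I h + 1) := by
  have h1 := sum_weightSeq_le h le_rfl
  have h2 : (1 : ℚ) ≤ 2 ^ (2 * inputSize I h) := one_le_pow₀ (by norm_num)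
  rw [pow_succ, infWeight]
  linarith

theorem infWeight_mem (h : List (State I)) : infWeight I ∈ fractions (commonDen I h) :=
  add_mem (sum_mem fun i _ => weightSeq_mem h i)
    (by exact_mod_cast intCast_mem_fractions (commonDen_ne_zero I h) 1)

theorem weightTable_nonneg (k u : ℕ) : 0 ≤ weightTable h r k u :=
  minWeight_nonneg weightSeq_nonneg infWeight_pos.le k u

theorem weightTable_le (k u : ℕ) : weightTable h r k u ≤ infWeight I :=
  minWeight_le infWeight_pos.le k u

theorem weightTable_mem (k u : ℕ) : weightTable h r k u ∈ fractions (commonDen I h) :=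
  minWeight_mem (weightSeq_mem h) (infWeight_mem h) k u

theorem initMem_one (j : ℕ) : initMem I h r 1 j = weightSeq I j := by
  simp [initMem, weightSeq]

theorem initMem_two_cases (j : ℕ) : initMem I h r 2 j = 0 ∨
    ∃ y ∈ h, ∃ i, initMem I h r 2 j = y.profit i := by
  simp only [initMem]
  split_ifs with hn
  · cases hj : h[j / I.n]? with
    | none => exact Or.inl rfl
    | some y => exact Or.inr ⟨y, List.mem_of_getElem? hj, _, rfl⟩
  · exact Or.inl rfl

theorem initMem_three_cases (j : ℕ) : initMem I h r 3 j = 0 ∨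
    ∃ y ∈ h, initMem I h r 3 j = y.B := by
  simp only [initMem]
  cases hj : h[j]? with
  | none => exact Or.inl rfl
  | some y => exact Or.inr ⟨y, List.mem_of_getElem? hj, rfl⟩

theorem initMem_two_mem (j : ℕ) : initMem I h r 2 j ∈ fractions (commonDen I h) := by
  rcases initMem_two_cases (r := r) (h := h) j with e | ⟨y, hy, i, e⟩ <;> rw [e]
  · exact zero_mem _
  · exact mem_fractions_commonDen (profit_mem_inputs hy i)

theorem initMem_two_nonneg (j : ℕ) : 0 ≤ initMem I h r 2 j := by
  rcases initMem_two_cases (r := r) (h := h) j with e | ⟨y, hy, i, e⟩ <;> rw [e]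
  exact y.profit_nonneg i

theorem initMem_two_le (j : ℕ) : initMem I h r 2 j ≤ 2 ^ inputSize I h := by
  rcases initMem_two_cases (r := r) (h := h) j with e | ⟨y, hy, i, e⟩ <;> rw [e]
  · positivity
  · exact le_two_pow_inputSize (profit_mem_inputs hy i)

theorem initMem_three_mem (j : ℕ) : initMem I h r 3 j ∈ fractions (commonDen I h) := by
  rcases initMem_three_cases (r := r) (h := h) j with e | ⟨y, hy, e⟩ <;> rw [e]
  · exact zero_mem _
  · exact mem_fractions_commonDen (capacity_mem_inputs hy)

theorem initMem_three_nonneg (j : ℕ) : 0 ≤ initMem I h r 3 j := by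
  rcases initMem_three_cases (r := r) (h := h) j with e | ⟨y, hy, e⟩ <;> rw [e]
  exact y.B_nonneg

theorem penaltySum_nonneg (w : ℚ) (j : ℕ) : 0 ≤ penaltySum h r w j :=
  Finset.sum_nonneg fun _ _ => mul_nonneg I.c_nonneg (le_max_left _ _)

theorem penaltySum_le {w : ℚ} (hw : w ≤ infWeight I) {j : ℕ} (hj : j ≤ h.length) :
    penaltySum h r w j ≤ 2 ^ (4 * inputSize I h + 1) := by
  have e : (2 : ℚ) ^ (4 * inputSize I h + 1) =
      2 ^ inputSize I h * (2 ^ inputSize I h * 2 ^ (2 * inputSize I h + 1)) := by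
    rw [← pow_add, ← pow_add]
    congr 1
    ring
  rw [e]
  refine sum_range_le_mul (fun s => ?_) (by positivity)
    (by have := length_le_inputSize I h; omega)
  refine mul_le_mul (le_two_pow_inputSize (rate_mem_inputs h)) ?_ (le_max_left _ _) (by positivity)
  refine max_le (by positivity) ?_
  have h1 := initMem_three_nonneg (h := h) (r := r) s
  have h2 := infWeight_le h
  linarith

theorem penaltySum_mem {w : ℚ} (hw : w ∈ fractions (commonDen I h)) (j : ℕ) :
    penaltySum h r w j ∈ fractions (commonDen I h * commonDen I h) := by
  refine sum_mem fun s _ => mul_mem_fractions (mem_fractions_commonDen (rate_mem_inputs h)) ?_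
  rcases max_choice 0 (w - initMem I h r 3 s) with e | e <;> rw [e]
  · exact zero_mem _
  · exact sub_mem hw (initMem_three_mem s)

theorem ratSize_le_memBound_of_mem {q : ℚ}
    (hq : q ∈ fractions (commonDen I h * commonDen I h)) (h0 : 0 ≤ q)
    (hle : q ≤ 2 ^ (4 * inputSize I h + 1)) : ratSize q ≤ memBound (inputSize I h) := by
  have hD := commonDen_ne_zero I h
  have h1 := ratSize_le_of_mem_fractions (mul_ne_zero hD hD) hq (by rwa [abs_of_nonneg h0])
  have h2 := natSize_mul_le (commonDen I h) (commonDen I h)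
  have h3 := natSize_commonDen_le I h
  unfold memBound
  omega

theorem fractions_le_mul {D E : ℕ} (hE : E ≠ 0) : fractions D ≤ fractions (D * E) := by
  intro q hq
  have := mul_mem_fractions hq (intCast_mem_fractions hE 1)
  rwa [Int.cast_one, mul_one] at this

theorem ratSize_le_memBound_of_natCast {k : ℕ} (hk : k.size + 2 ≤ memBound (inputSize I h)) :
    ratSize (k : ℚ) ≤ memBound (inputSize I h) := by
  rwa [ratSize_natCast]

theorem small_initMem : Small (memBound (inputSize I h)) (initMem I h r) := by
  have hin : ∀ q ∈ inputs I h, ratSize q ≤ memBound (inputSize I h) := fun q hq => by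
    have := ratSize_le_inputSize hq
    unfold memBound
    omega
  have hnat : ∀ k : ℕ, k ≤ inputSize I h + 1 → ratSize (k : ℚ) ≤ memBound (inputSize I h) :=
    fun k hk => by
      have := ratSize_natCast_le k
      unfold memBound
      omega
  have h0 : ratSize (0 : ℚ) ≤ memBound (inputSize I h) := by
    have := hnat 0 (by omega)
    rwa [Nat.cast_zero] at this
  have h1 : ratSize (1 : ℚ) ≤ memBound (inputSize I h) := by
    have := hnat 1 (by omega)
    rwa [Nat.cast_one] at this
  intro a c
  unfold initMem
  split
  · exact hnat _ (by have := card_le_inputSize I h; omega)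
  · exact hnat _ (by have := length_le_inputSize I h; omega)
  · exact hin _ (rate_mem_inputs h)
  · exact hin _ (bound_mem_inputs h)
  · split_ifs
    · exact hin _ (weight_mem_inputs h _)
    · exact h0
  · rcases initMem_two_cases (r := r) (h := h) c with e | ⟨y, hy, i, e⟩
    · simp only [initMem] at e
      rw [e]
      exact h0
    · simp only [initMem] at e
      rw [e]
      exact hin _ (profit_mem_inputs hy i)
  · rcases initMem_three_cases (r := r) (h := h) c with e | ⟨y, hy, e⟩
    · simp only [initMem] at e
      rw [e]
      exact h0
    · simp only [initMem] at e
      rw [e]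
      exact hin _ (capacity_mem_inputs hy)
  · split_ifs
    · exact h1
    · exact h0
    · exact h0
  · exact h0

theorem ratSize_contents_le (a : ℕ) :
    ∀ i < filled h r a, ratSize (contents h r a i) ≤ memBound (inputSize I h) := by
  intro i hi
  have hD := commonDen_ne_zero I h
  have hn := card_le_inputSize I h
  have ht := length_le_inputSize I h
  have hJ := noiseBits_le h.length
  have hfa := filled_le (h := h) (r := r) a
  have hN : 8 * inputSize I h + 10 ≤ memBound (inputSize I h) := by
    unfold memBound
    omega
  have hpow : ∀ k ≤ 2 * inputSize I h, ratSize ((2 : ℚ) ^ k - 1) ≤ memBound (inputSize I h) := by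
    intro k hk
    have e : ((2 : ℚ) ^ k - 1) = ((2 ^ k - 1 : ℕ) : ℚ) := by
      rw [Nat.cast_sub Nat.one_le_two_pow]
      push_cast
      rfl
    rw [e]
    refine ratSize_le_memBound_of_natCast ?_
    have : (2 ^ k - 1).size ≤ k := Nat.size_le.mpr (by have := Nat.one_le_two_pow (n := k); omega)
    omega
  have h4 : (2 : ℚ) ^ (2 * inputSize I h + 1) ≤ 2 ^ (4 * inputSize I h + 1) :=
    pow_le_pow_right₀ (by norm_num) (by omega)
  have h4' : (2 : ℚ) ^ (2 * inputSize I h) ≤ 2 ^ (4 * inputSize I h + 1) :=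
    pow_le_pow_right₀ (by norm_num) (by omega)
  have hsmall : ∀ k : ℕ, k + 2 ≤ memBound (inputSize I h) →
      ratSize (k : ℚ) ≤ memBound (inputSize I h) := fun k hk => (ratSize_natCast_le k).trans hk
  have hwd : tableWidth h r + 4 ≤ memBound (inputSize I h) := filled_le (h := h) (r := r) 19
  unfold contents
  split
  · refine hsmall _ ?_
    have := Nat.mod_lt (codeTable h r I.n (bestValue h r (tableWidth h r)) / 2 ^ i) two_pos
    omega
  · have hi' : i < I.n + 1 := hi
    exact ratSize_le_memBound_of_mem
      (fractions_le_mul hD (sum_mem fun i _ => weightSeq_mem h i)) (sum_weightSeq_nonneg _)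
      ((sum_weightSeq_le h (by omega)).trans h4')
  · have hi' : i < h.length + 1 := hi
    have := hpow (2 * i) (by omega)
    rwa [pow_mul, show (2 : ℚ) ^ 2 = 4 by norm_num] at this
  · have hi' : i < h.length + 1 := hi
    exact hsmall _ (by have := min_le_left i (noiseBits h.length); omega)
  · have hi' : i < (h.length + 1) * I.n := hi
    have h1 : i / I.n < h.length + 1 := Nat.div_lt_of_lt_mul (by rwa [mul_comm])
    refine ratSize_le_memBound_of_mem
      (fractions_le_mul hD (sum_mem fun i _ => initMem_two_mem _))
      (Finset.sum_nonneg fun i _ => initMem_two_nonneg _)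
      ((sum_range_le_mul (N := inputSize I h) (b := 2 ^ inputSize I h)
        (fun i => initMem_two_le _) (by positivity) (by omega)).trans ?_)
    rwa [← pow_add, ← two_mul]
  · have hi' : i < (noiseBits h.length + 1) * I.n := hi
    have h1 : i / I.n < noiseBits h.length + 1 := Nat.div_lt_of_lt_mul (by rwa [mul_comm])
    refine ratSize_le_memBound_of_natCast ?_
    have := Nat.size_le.mpr (noise_lt r I.n (i % I.n) (i / I.n))
    omega
  · refine hsmall _ ?_
    have := valueSeq_le (h := h) (r := r) i
    omega
  · have hi' : i < I.n + 1 := hi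
    have h1 : ∑ j ∈ Finset.range i, valueSeq h r j ≤ ∑ j ∈ Finset.range I.n, valueSeq h r j :=
      Finset.sum_le_sum_of_subset (Finset.range_subset_range.mpr (by omega))
    unfold tableWidth at hwd
    exact hsmall _ (by omega)
  · exact ratSize_le_memBound_of_mem (fractions_le_mul hD (weightTable_mem _ _))
      (weightTable_nonneg _ _) ((weightTable_le _ _).trans ((infWeight_le h).trans h4))
  · have hi' : i < I.n + 1 := hi
    exact hpow i (by omega)
  · have hi' : i < (I.n + 1) * tableWidth h r := hi
    have h1 : i / tableWidth h r < I.n + 1 := Nat.div_lt_of_lt_mul (by rwa [mul_comm])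
    refine ratSize_le_memBound_of_natCast ?_
    have := Nat.size_le.mpr (minWeightCode_lt (v := valueSeq h r) (w := weightSeq I)
      (inf := infWeight I) (i / tableWidth h r) (i % tableWidth h r))
    unfold codeTable
    omega
  · have hi' : i < (h.length + 1) * tableWidth h r := hi
    have h1 : i / tableWidth h r < h.length + 1 := Nat.div_lt_of_lt_mul (by rwa [mul_comm])
    exact ratSize_le_memBound_of_mem (penaltySum_mem (weightTable_mem _ _) _)
      (penaltySum_nonneg _ _)
      (penaltySum_le (weightTable_le _ _) (by omega))
  · have hi' : i < tableWidth h r + 1 := hi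
    refine hsmall _ ?_
    have := bestIndex_le (fun u => weightTable h r I.n u ≤ ∑ i ∈ Finset.range I.n, weightSeq I i)
      (fun u => payoffRange I * u - penaltySum h r (weightTable h r I.n u) h.length) i
    unfold bestValue
    omega
  · have := hsmall 0 (by omega)
    rwa [Nat.cast_zero] at this

end Bounds

/-! ## Evaluation of expressions -/

section Eval

variable {σ : Mem} {e f c : Expr}

theorem eval_zero : (Expr.lit 0).eval σ = ((0 : ℕ) : ℚ) := by simp [Expr.eval]

theorem eval_one : (Expr.lit 1).eval σ = ((1 : ℕ) : ℚ) := by simp [Expr.eval]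

theorem eval_add_rat {p q : ℚ} (he : e.eval σ = p) (hf : f.eval σ = q) :
    (Expr.add e f).eval σ = p + q := by rw [Expr.eval, he, hf]

theorem eval_sub_rat {p q : ℚ} (he : e.eval σ = p) (hf : f.eval σ = q) :
    (Expr.sub e f).eval σ = p - q := by rw [Expr.eval, he, hf]

theorem eval_mul_rat {p q : ℚ} (he : e.eval σ = p) (hf : f.eval σ = q) :
    (Expr.mul e f).eval σ = p * q := by rw [Expr.eval, he, hf]

theorem eval_le {p q : ℚ} (he : e.eval σ = p) (hf : f.eval σ = q) :
    (Expr.le e f).eval σ = if p ≤ q then 1 else 0 := by rw [Expr.eval, he, hf]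

theorem eval_add {a b : ℕ} (he : e.eval σ = a) (hf : f.eval σ = b) :
    (Expr.add e f).eval σ = ((a + b : ℕ) : ℚ) := by
  rw [Expr.eval, he, hf, Nat.cast_add]

theorem eval_mul {a b : ℕ} (he : e.eval σ = a) (hf : f.eval σ = b) :
    (Expr.mul e f).eval σ = ((a * b : ℕ) : ℚ) := by
  rw [Expr.eval, he, hf, Nat.cast_mul]

theorem eval_sub {a b : ℕ} (he : e.eval σ = a) (hf : f.eval σ = b) (hba : b ≤ a) :
    (Expr.sub e f).eval σ = ((a - b : ℕ) : ℚ) := by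
  rw [Expr.eval, he, hf, Nat.cast_sub hba]

theorem eval_floor_div {a b : ℕ} (he : e.eval σ = a) (hf : f.eval σ = b) :
    (Expr.floor (.div e f)).eval σ = ((a / b : ℕ) : ℚ) := by
  rw [Expr.eval, Expr.eval, he, hf, Rat.floor_natCast_div_natCast]
  exact_mod_cast rfl

theorem eval_read {a k : ℕ} {q : ℚ} (he : e.eval σ = k) (hq : σ a k = q) :
    (Expr.read a e).eval σ = q := by
  rw [Expr.eval, he, Nat.floor_natCast, hq]

theorem eval_cond {p : Prop} [Decidable p] {q : ℚ} (hc : c.eval σ = if p then 1 else 0)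
    (he : p → e.eval σ = q) (hf : ¬ p → f.eval σ = q) : (Expr.cond c e f).eval σ = q := by
  rw [Expr.cond, Expr.eval, Expr.eval, Expr.eval, hc]
  split_ifs with h
  · rw [he h]
    ring
  · rw [hf h]
    ring

end Eval

section Steps

variable {I : Inst} {h : List (State I)} {m : ℕ} {r : Fin m → Bool} {S : List ℕ} {x : ℕ} {σ : Mem}

theorem Filled.items (hσ : Filled h r S x σ) (hx : 0 ≠ x := by decide) (hS : 0 ∉ S := by decide) :
    Expr.items.eval σ = I.n :=
  hσ.eval_init eval_zero (by decide) hx hS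

theorem Filled.rounds (hσ : Filled h r S x σ) (hx : 0 ≠ x := by decide) (hS : 0 ∉ S := by decide) :
    Expr.rounds.eval σ = h.length :=
  hσ.eval_init eval_one (by decide) hx hS

theorem Filled.rate (hσ : Filled h r S x σ) (hx : 0 ≠ x := by decide) (hS : 0 ∉ S := by decide) :
    Expr.rate.eval σ = I.c :=
  hσ.eval_init (k := 2) (by simp [Expr.eval]) (by decide) hx hS

theorem Filled.weight (hσ : Filled h r S x σ) (hx : 0 ≠ x := by decide) (hS : 0 ∉ S := by decide)
    (hx' : 8 ≠ x := by decide) (hS' : 8 ∈ S := by decide) :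
    Expr.weight.eval σ = ∑ i ∈ Finset.range I.n, weightSeq I i :=
  hσ.eval_contents (hσ.items hx hS) (Nat.lt_succ_self _) (by decide) hx' hS'

theorem Filled.range (hσ : Filled h r S x σ) (hx : 0 ≠ x := by decide) (hS : 0 ∉ S := by decide)
    (hx' : 8 ≠ x := by decide) (hS' : 8 ∈ S := by decide) :
    Expr.range.eval σ = payoffRange I := by
  have hP : (Expr.read 0 (.lit 3)).eval σ = I.P :=
    hσ.eval_init (k := 3) (by simp [Expr.eval]) (by decide) hx hS
  rw [payoffRange, ← sum_weightSeq]
  exact eval_add_rat (eval_mul_rat (hσ.items hx hS) hP)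
    (eval_mul_rat (hσ.rate hx hS) (hσ.weight hx hS hx' hS'))

theorem Filled.bits (hσ : Filled h r S x σ) (hx : 0 ≠ x := by decide) (hS : 0 ∉ S := by decide)
    (hx' : 10 ≠ x := by decide) (hS' : 10 ∈ S := by decide) :
    Expr.bits.eval σ = noiseBits h.length := by
  rw [Expr.bits, hσ.eval_contents (hσ.rounds hx hS) (Nat.lt_succ_self _) (by decide) hx' hS']
  simp only [contents, min_eq_right (noiseBits_le h.length)]

theorem Filled.width (hσ : Filled h r S x σ) (hx : 0 ≠ x := by decide) (hS : 0 ∉ S := by decide)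
    (hx' : 14 ≠ x := by decide) (hS' : 14 ∈ S := by decide) :
    Expr.width.eval σ = tableWidth h r :=
  eval_add (hσ.eval_contents (hσ.items hx hS) (Nat.lt_succ_self _) (by decide) hx' hS') eval_one

theorem Filled.row {j : ℕ} (hσ : Filled h r S x σ) (hj : Expr.ctr.eval σ = j)
    (hx : 0 ≠ x := by decide) (hS : 0 ∉ S := by decide)
    (hx' : 14 ≠ x := by decide) (hS' : 14 ∈ S := by decide) :
    Expr.row.eval σ = ((j / tableWidth h r : ℕ) : ℚ) :=
  eval_floor_div hj (hσ.width hx hS hx' hS')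

theorem Filled.col {j : ℕ} (hσ : Filled h r S x σ) (hj : Expr.ctr.eval σ = j)
    (hx : 0 ≠ x := by decide) (hS : 0 ∉ S := by decide)
    (hx' : 14 ≠ x := by decide) (hS' : 14 ∈ S := by decide) :
    Expr.col.eval σ = ((j % tableWidth h r : ℕ) : ℚ) := by
  have e : j - j / tableWidth h r * tableWidth h r = j % tableWidth h r := by
    have := Nat.div_add_mod' j (tableWidth h r)
    omega
  rw [← e]
  exact eval_sub hj (eval_mul (hσ.row hj hx hS hx' hS') (hσ.width hx hS hx' hS'))
    (Nat.div_mul_le_self _ _)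

theorem table_div {k u V : ℕ} (hu : u < V) : (k * V + u) / V = k := by
  rw [mul_comm, Nat.mul_add_div (by omega), Nat.div_eq_of_lt hu, add_zero]

theorem table_mod {k u V : ℕ} (hu : u < V) : (k * V + u) % V = u := Nat.mul_add_mod_of_lt hu

theorem table_lt {k u V n : ℕ} (hk : k < n) (hu : u < V) : k * V + u < n * V := by
  have : (k + 1) * V ≤ n * V := Nat.mul_le_mul_right _ hk
  rw [add_mul] at this
  omega

theorem contents_weight {k u : ℕ} (hu : u < tableWidth h r) :
    contents h r 15 (k * tableWidth h r + u) = weightTable h r k u := by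
  rw [contents, table_div hu, table_mod hu]

theorem contents_code {k u : ℕ} (hu : u < tableWidth h r) :
    contents h r 17 (k * tableWidth h r + u) = codeTable h r k u := by
  rw [contents, table_div hu, table_mod hu]

theorem contents_penalty {k u : ℕ} (hu : u < tableWidth h r) :
    contents h r 18 (k * tableWidth h r + u) = penaltySum h r (weightTable h r I.n u) k := by
  rw [contents, table_div hu, table_mod hu]

theorem eval_source {i k : Expr} {V K U v : ℕ} (hv : (Expr.read 13 k).eval σ = v)
    (hi : i.eval σ = ((K * V + U : ℕ) : ℚ)) (hvU : v ≤ U) :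
    (Expr.source i k).eval σ = ((K * V + (U - v) : ℕ) : ℚ) := by
  rw [← Nat.add_sub_assoc hvU]
  exact eval_sub hi hv (by omega)

theorem eval_take {i k u : Expr} {K U : ℕ} (hv : (Expr.read 13 k).eval σ = valueSeq h r K)
    (hw : (Expr.read 1 k).eval σ = weightSeq I K)
    (hi : i.eval σ = ((K * tableWidth h r + U : ℕ) : ℚ)) (hu : u.eval σ = U)
    (ht : ∀ U' ≤ U, σ 15 (K * tableWidth h r + U') = weightTable h r K U') :
    (Expr.take i k u).eval σ = if valueSeq h r K ≤ U ∧
      weightTable h r K (U - valueSeq h r K) + weightSeq I K ≤ weightTable h r K U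
      then 1 else 0 := by
  rw [Expr.take, eval_mul_rat (eval_le hv hu) rfl]
  by_cases hvU : valueSeq h r K ≤ U
  · rw [if_pos (by exact_mod_cast hvU), one_mul,
      eval_le (eval_add_rat (eval_read (eval_source hv hi hvU) (ht _ (Nat.sub_le _ _))) hw)
        (eval_read hi (ht U le_rfl))]
    simp only [hvU, true_and]
  · rw [if_neg (by exact_mod_cast hvU), zero_mul, if_neg fun hc => hvU hc.1]

/-- Filling array `a`. -/
theorem Filled.fill {a : ℕ} (o M : ℕ) {off bound e : Expr} (hσ : Filled h r S 7 σ)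
    (hs : Small (memBound (inputSize I h)) σ) (hlen : o + M = filled h r a)
    (h0 : ∀ i < o, initMem I h r a i = contents h r a i)
    (hoff : ∀ σ, Filled h r S a σ → off.eval σ = o)
    (hbound : ∀ σ, Filled h r S a σ → bound.eval σ = M)
    (he : ∀ σ j, Filled h r S a σ → Expr.ctr.eval σ = (j : ℕ) → j < M →
      (∀ i < o + j, σ a i = contents h r a i) → e.eval σ = contents h r a (o + j))
    (ha : a ≠ 7 := by decide) (haS : a ∉ S := by decide) :
    Runs (memBound (inputSize I h)) (fill a off bound e) σ (Filled h r (a :: S) 7) := by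
  have hfr : ∀ σ', Frame a σ σ' → Filled h r S a σ' := by
    intro σ' hfr a' h7 hax
    rw [hfr a' hax h7]
    exact hσ a' h7 h7
  obtain ⟨σ', k, hk, hkle, hs', hframe, hv⟩ :=
    runs_fill hs ha (by have := filled_le (h := h) (r := r) a; omega) (F := contents h r a)
      (fun i hi => by rw [(hσ a ha ha).2 haS]; exact h0 i hi)
      (fun σ' hσ' => hoff σ' (hfr σ' hσ')) (fun σ' hσ' => hbound σ' (hfr σ' hσ'))
      (fun σ' j hσ' => he σ' j (hfr σ' hσ'))
      (fun j hj => ratSize_contents_le a _ (by omega))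
  refine ⟨σ', k, hk, hkle, hs', fun a' h7 _ => ?_⟩
  by_cases hax : a' = a
  · subst hax
    exact ⟨fun _ i hi => hv i (by omega), fun hn => absurd List.mem_cons_self hn⟩
  · have := hfr σ' hframe a' h7 hax
    simpa [hax] using this

end Steps

/-! ## Correctness of the program -/

section Phases

variable {I : Inst} {h : List (State I)} {m : ℕ} {r : Fin m → Bool} {σ : Mem}

theorem initMem_eq_zero {a : ℕ} (ha : 5 ≤ a) (j : ℕ) : initMem I h r a j = 0 := by
  unfold initMem
  split <;> first | rfl | omega

theorem runs_sumWeights (hs : Small (memBound (inputSize I h)) σ) (hσ : Filled h r [] 7 σ) :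
    Runs (memBound (inputSize I h)) sumWeights σ (Filled h r [8] 7) := by
  refine hσ.fill 1 I.n hs (add_comm _ _) (fun i hi => ?_) (fun _ _ => eval_one)
    (fun σ hσ => hσ.items) fun σ j hσ hj hjM hv => ?_
  · rw [initMem_eq_zero (by norm_num), Nat.lt_one_iff.mp hi, contents, Finset.sum_range_zero]
  · rw [eval_add_rat (eval_read hj (hv j (by omega))) (hσ.eval_init hj), initMem_one, contents,
      contents, add_comm 1 j, Finset.sum_range_succ]

theorem runs_powersOfFour (hs : Small (memBound (inputSize I h)) σ) (hσ : Filled h r [8] 7 σ) :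
    Runs (memBound (inputSize I h)) powersOfFour σ (Filled h r [9, 8] 7) := by
  refine hσ.fill 1 h.length hs (add_comm _ _) (fun i hi => ?_) (fun _ _ => eval_one)
    (fun σ hσ => hσ.rounds) fun σ j hσ hj hjM hv => ?_
  · rw [initMem_eq_zero (by norm_num), Nat.lt_one_iff.mp hi, contents, pow_zero, sub_self]
  · rw [eval_add_rat (eval_mul_rat rfl (eval_read hj (hv j (by omega)))) rfl, contents, contents,
      Expr.eval, Expr.eval, pow_add]
    ring

theorem runs_countBits (hs : Small (memBound (inputSize I h)) σ) (hσ : Filled h r [9, 8] 7 σ) :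
    Runs (memBound (inputSize I h)) countBits σ (Filled h r [10, 9, 8] 7) := by
  refine hσ.fill 1 h.length hs (add_comm _ _) (fun i hi => ?_) (fun _ _ => eval_one)
    (fun σ hσ => hσ.rounds) fun σ j hσ hj hjM hv => ?_
  · rw [initMem_eq_zero (by norm_num), Nat.lt_one_iff.mp hi, contents, Nat.zero_min, Nat.cast_zero]
  · rw [eval_add_rat (eval_read hj (hv j (by omega)))
      (eval_le (hσ.eval_contents (a := 9) (eval_add hj eval_one) (Nat.succ_lt_succ hjM)) hσ.rounds),
      contents, contents, contents]
    have key : (4 : ℚ) ^ (j + 1) - 1 ≤ h.length ↔ j + 1 ≤ noiseBits h.length := by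
      rw [noiseBits, Nat.le_log_iff_pow_le (by norm_num) (Nat.succ_ne_zero _), sub_le_iff_le_add]
      exact_mod_cast Iff.rfl
    rw [add_comm 1 j]
    by_cases hc : j + 1 ≤ noiseBits h.length
    · rw [if_pos (key.mpr hc), min_eq_left hc, min_eq_left (by omega), Nat.cast_succ]
    · rw [if_neg (mt key.mp hc), min_eq_right (by omega), min_eq_right (by omega), add_zero]

theorem runs_sumProfits (hs : Small (memBound (inputSize I h)) σ)
    (hσ : Filled h r [10, 9, 8] 7 σ) :
    Runs (memBound (inputSize I h)) sumProfits σ (Filled h r [11, 10, 9, 8] 7) := by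
  refine hσ.fill I.n (h.length * I.n) hs (by rw [filled]; ring) (fun i hi => ?_)
    (fun σ hσ => hσ.items) (fun σ hσ => eval_mul hσ.rounds hσ.items) fun σ j hσ hj hjM hv => ?_
  · rw [initMem_eq_zero (by norm_num), contents, Nat.div_eq_of_lt hi, Finset.sum_range_zero]
  · have hn : 0 < I.n := Nat.pos_of_ne_zero fun h0 => by simp [h0] at hjM
    rw [eval_add_rat (eval_read hj (hv j (by omega))) (hσ.eval_init hj), contents, contents,
      Nat.add_mod_left, Nat.add_div_left _ hn, Finset.sum_range_succ, Nat.div_add_mod']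

theorem runs_drawNoise (hs : Small (memBound (inputSize I h)) σ)
    (hσ : Filled h r [11, 10, 9, 8] 7 σ) :
    Runs (memBound (inputSize I h)) drawNoise σ (Filled h r [12, 11, 10, 9, 8] 7) := by
  refine hσ.fill I.n (noiseBits h.length * I.n) hs (by rw [filled]; ring) (fun i hi => ?_)
    (fun σ hσ => hσ.items) (fun σ hσ => eval_mul hσ.bits hσ.items) fun σ j hσ hj hjM hv => ?_
  · rw [initMem_eq_zero (by norm_num), contents, Nat.div_eq_of_lt hi, noise, Nat.cast_zero]
  · have hn : 0 < I.n := Nat.pos_of_ne_zero fun h0 => by simp [h0] at hjM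
    rw [eval_add_rat (eval_mul_rat rfl (eval_read hj (hv j (by omega)))) (hσ.eval_init hj),
      contents, contents, Nat.add_mod_left, Nat.add_div_left _ hn, noise, Expr.eval]
    simp only [Nat.div_add_mod', initMem]
    push_cast
    congr 1
    split_ifs <;> simp

theorem valueSeq_eq {i : ℕ} (hi : i < I.n) :
    (valueSeq h r i : ℚ) = ((⌊contents h r 11 (h.length * I.n + i) / payoffRange I⌋ : ℤ) : ℚ) +
      contents h r 12 (noiseBits h.length * I.n + i) := by
  have hprofit : contents h r 11 (h.length * I.n + i) = totalProfit h ⟨i, hi⟩ := by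
    rw [contents, table_div hi, table_mod hi, totalProfit, Finset.sum_range]
    have hn : 0 < I.n := by omega
    rw [← List.sum_ofFn]
    congr 1
    refine List.ext_getElem (by simp) fun s h1 h2 => ?_
    simp only [List.getElem_ofFn, List.getElem_map, initMem, hn, dif_pos, table_div hi,
      table_mod hi]
    rw [List.getElem?_eq_getElem]
    rfl
  rw [hprofit, contents, table_div hi, table_mod hi, valueSeq, dif_pos hi, profitUnits, Nat.cast_add,
    natCast_floor_eq_intCast_floor (div_nonneg (totalProfit_nonneg h _) (payoffRange_nonneg I))]

theorem runs_perturbProfits (hs : Small (memBound (inputSize I h)) σ)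
    (hσ : Filled h r [12, 11, 10, 9, 8] 7 σ) :
    Runs (memBound (inputSize I h)) perturbProfits σ (Filled h r [13, 12, 11, 10, 9, 8] 7) := by
  refine hσ.fill 0 I.n hs (zero_add _) (fun i hi => by omega) (fun _ _ => eval_zero)
    (fun σ hσ => hσ.items) fun σ j hσ hj hjM hv => ?_
  rw [eval_add_rat rfl (hσ.eval_contents (eval_add (eval_mul hσ.bits hσ.items) hj)
    (by rw [filled]; exact table_lt (Nat.lt_succ_self _) hjM)), Expr.eval, Expr.eval, hσ.range,
    hσ.eval_contents (eval_add (eval_mul hσ.rounds hσ.items) hj)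
    (by rw [filled]; exact table_lt (Nat.lt_succ_self _) hjM), zero_add, ← valueSeq_eq hjM]
  rfl

theorem runs_sumValues (hs : Small (memBound (inputSize I h)) σ)
    (hσ : Filled h r [13, 12, 11, 10, 9, 8] 7 σ) :
    Runs (memBound (inputSize I h)) sumValues σ (Filled h r [14, 13, 12, 11, 10, 9, 8] 7) := by
  refine hσ.fill 1 I.n hs (add_comm _ _) (fun i hi => ?_) (fun _ _ => eval_one)
    (fun σ hσ => hσ.items) fun σ j hσ hj hjM hv => ?_
  · rw [initMem_eq_zero (by norm_num), Nat.lt_one_iff.mp hi, contents, Finset.sum_range_zero,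
      Nat.cast_zero]
  · rw [eval_add_rat (eval_read hj (hv j (by omega))) (hσ.eval_contents (a := 13) hj hjM), contents,
      contents, contents, add_comm 1 j, Finset.sum_range_succ, Nat.cast_add]

theorem runs_fillWeightTable (hs : Small (memBound (inputSize I h)) σ)
    (hσ : Filled h r [14, 13, 12, 11, 10, 9, 8] 7 σ) :
    Runs (memBound (inputSize I h)) fillWeightTable σ
      (Filled h r [15, 14, 13, 12, 11, 10, 9, 8] 7) := by
  refine hσ.fill 0 ((I.n + 1) * tableWidth h r) hs (zero_add _) (fun i hi => by omega)
    (fun _ _ => eval_zero) (fun σ hσ => eval_mul (eval_add hσ.items eval_one) hσ.width)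
    fun σ j hσ hj hjM hv => ?_
  rw [zero_add] at hv ⊢
  have hV := tableWidth_pos (h := h) (r := r)
  refine eval_cond (p := tableWidth h r ≤ j) ?_ (fun hle => ?_) fun hlt => ?_
  · rw [eval_le hσ.width hj]
    simp only [Nat.cast_le]
  · obtain ⟨K, hK⟩ : ∃ K, j / tableWidth h r = K + 1 :=
      Nat.exists_eq_succ_of_ne_zero (Nat.div_pos hle hV).ne'
    have hu : j % tableWidth h r < tableWidth h r := Nat.mod_lt _ hV
    have hKn : K < I.n := by
      have : j / tableWidth h r < I.n + 1 := Nat.div_lt_of_lt_mul (by rwa [mul_comm])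
      omega
    have ej : j = (K + 1) * tableWidth h r + j % tableWidth h r := by
      rw [← hK, Nat.div_add_mod']
    generalize hU : j % tableWidth h r = U at hu ej
    have ej' : j - tableWidth h r = K * tableWidth h r + U := by
      rw [add_mul] at ej
      omega
    have hcol : Expr.col.eval σ = U := by rw [hσ.col hj, hU]
    have hrow : (Expr.sub .row (.lit 1)).eval σ = K := by
      have := eval_sub (hσ.row hj) (eval_one (σ := σ)) (by omega)
      rwa [hK, Nat.add_sub_cancel] at this
    have hidx : (Expr.sub .ctr .width).eval σ = ((K * tableWidth h r + U : ℕ) : ℚ) := by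
      rw [← ej']
      exact eval_sub hj hσ.width hle
    have hval : (Expr.read 13 (.sub .row (.lit 1))).eval σ = valueSeq h r K :=
      hσ.eval_contents hrow hKn
    have hwt : (Expr.read 1 (.sub .row (.lit 1))).eval σ = weightSeq I K := by
      rw [hσ.eval_init hrow, initMem_one]
    have ht : ∀ U' ≤ U, σ 15 (K * tableWidth h r + U') = weightTable h r K U' := by
      intro U' hU'
      rw [hv _ (by omega), contents_weight (by omega)]
    have hcont : contents h r 15 j = weightTable h r (K + 1) U := by
      rw [ej, contents_weight hu]
    rw [hcont, weightTable, minWeight]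
    refine eval_cond (eval_take hval hwt hidx hcol ht) (fun hc => ?_) fun hc => ?_
    · exact (eval_add_rat (eval_read (eval_source hval hidx hc.1) (ht _ (Nat.sub_le _ _))) hwt).trans
        (if_pos hc).symm
    · exact (eval_read hidx (ht U le_rfl)).trans (if_neg hc).symm
  · have hcont : contents h r 15 j = if j = 0 then 0 else infWeight I := by
      rw [contents, Nat.div_eq_of_lt (not_le.mp hlt), Nat.mod_eq_of_lt (not_le.mp hlt), weightTable,
        minWeight]
    rw [hcont]
    refine eval_cond (p := j = 0) ?_ (fun hc => ?_) fun hc => ?_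
    · rw [eval_le hj eval_zero]
      simp only [Nat.cast_le, Nat.le_zero]
    · rw [if_pos hc, Expr.eval]
    · rw [if_neg hc, eval_add_rat hσ.weight eval_one, infWeight, Nat.cast_one]

theorem runs_powersOfTwo (hs : Small (memBound (inputSize I h)) σ)
    (hσ : Filled h r [15, 14, 13, 12, 11, 10, 9, 8] 7 σ) :
    Runs (memBound (inputSize I h)) powersOfTwo σ
      (Filled h r [16, 15, 14, 13, 12, 11, 10, 9, 8] 7) := by
  refine hσ.fill 1 I.n hs (add_comm _ _) (fun i hi => ?_) (fun _ _ => eval_one)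
    (fun σ hσ => hσ.items) fun σ j hσ hj hjM hv => ?_
  · rw [initMem_eq_zero (by norm_num), Nat.lt_one_iff.mp hi, contents, pow_zero, sub_self]
  · rw [eval_add_rat (eval_mul_rat rfl (eval_read hj (hv j (by omega)))) rfl, contents, contents,
      Expr.eval, Expr.eval, pow_add]
    ring

theorem runs_fillCodeTable (hs : Small (memBound (inputSize I h)) σ)
    (hσ : Filled h r [16, 15, 14, 13, 12, 11, 10, 9, 8] 7 σ) :
    Runs (memBound (inputSize I h)) fillCodeTable σ
      (Filled h r [17, 16, 15, 14, 13, 12, 11, 10, 9, 8] 7) := by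
  refine hσ.fill (tableWidth h r) (I.n * tableWidth h r) hs (by rw [filled]; ring) (fun i hi => ?_)
    (fun σ hσ => hσ.width) (fun σ hσ => eval_mul hσ.items hσ.width) fun σ j hσ hj hjM hv => ?_
  · rw [initMem_eq_zero (by norm_num), contents, Nat.div_eq_of_lt hi, codeTable, minWeightCode,
      Nat.cast_zero]
  · have hV := tableWidth_pos (h := h) (r := r)
    have hu : j % tableWidth h r < tableWidth h r := Nat.mod_lt _ hV
    have hKn : j / tableWidth h r < I.n := Nat.div_lt_of_lt_mul (by rwa [mul_comm])
    have ej : j = j / tableWidth h r * tableWidth h r + j % tableWidth h r :=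
      (Nat.div_add_mod' _ _).symm
    have hcol := hσ.col hj
    have hrow := hσ.row hj
    generalize j % tableWidth h r = U at hu ej hcol
    generalize j / tableWidth h r = K at hKn ej hrow
    have hidx : Expr.ctr.eval σ = ((K * tableWidth h r + U : ℕ) : ℚ) := by rw [← ej, hj]
    have hval : (Expr.read 13 .row).eval σ = valueSeq h r K := hσ.eval_contents hrow hKn
    have hwt : (Expr.read 1 .row).eval σ = weightSeq I K := by rw [hσ.eval_init hrow, initMem_one]
    have hpow : (Expr.add (.read 16 .row) (.lit 1)).eval σ = ((2 ^ K : ℕ) : ℚ) := by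
      rw [eval_add_rat (hσ.eval_contents (a := 16) hrow (Nat.lt_succ_of_lt hKn)) eval_one, contents]
      push_cast
      ring
    have ht : ∀ U' ≤ U, σ 15 (K * tableWidth h r + U') = weightTable h r K U' := by
      intro U' hU'
      rw [(hσ 15 (by decide) (by decide)).1 (by decide) _
        (by rw [filled]; exact table_lt (by omega) (by omega)), contents_weight (by omega)]
    have hcode : ∀ U' ≤ U, σ 17 (K * tableWidth h r + U') = codeTable h r K U' := by
      intro U' hU'
      rw [hv _ (by omega), contents_code (by omega)]
    have hcont : contents h r 17 (tableWidth h r + j) = codeTable h r (K + 1) U := by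
      rw [ej, show tableWidth h r + (K * tableWidth h r + U) = (K + 1) * tableWidth h r + U by ring,
        contents_code hu]
    rw [hcont, codeTable, minWeightCode]
    refine eval_cond (eval_take hval hwt hidx hcol ht) (fun hc => ?_) fun hc => ?_
    · rw [eval_add_rat (eval_read (eval_source hval hidx hc.1) (hcode _ (Nat.sub_le _ _))) hpow,
        ← Nat.cast_add]
      exact congrArg _ (if_pos hc).symm
    · rw [eval_read hidx (hcode U le_rfl)]
      exact congrArg _ (if_neg hc).symm

theorem eval_minWeight {S : List ℕ} {x : ℕ} {u : Expr} {U : ℕ} (hσ : Filled h r S x σ)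
    (hu : u.eval σ = U) (hU : U < tableWidth h r)
    (hx : 0 ≠ x := by decide) (hS : 0 ∉ S := by decide)
    (hx' : 14 ≠ x := by decide) (hS' : 14 ∈ S := by decide)
    (hx'' : 15 ≠ x := by decide) (hS'' : 15 ∈ S := by decide) :
    (Expr.minWeight u).eval σ = weightTable h r I.n U := by
  rw [Expr.minWeight, hσ.eval_contents
    (eval_add (eval_mul (hσ.items hx hS) (hσ.width hx hS hx' hS')) hu)
    (by rw [filled]; exact table_lt (Nat.lt_succ_self _) hU) (by decide) hx'' hS'',
    contents_weight hU]

theorem runs_sumPenalties (hs : Small (memBound (inputSize I h)) σ)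
    (hσ : Filled h r [17, 16, 15, 14, 13, 12, 11, 10, 9, 8] 7 σ) :
    Runs (memBound (inputSize I h)) sumPenalties σ
      (Filled h r [18, 17, 16, 15, 14, 13, 12, 11, 10, 9, 8] 7) := by
  refine hσ.fill (tableWidth h r) (h.length * tableWidth h r) hs (by rw [filled]; ring)
    (fun i hi => ?_) (fun σ hσ => hσ.width) (fun σ hσ => eval_mul hσ.rounds hσ.width)
    fun σ j hσ hj hjM hv => ?_
  · rw [initMem_eq_zero (by norm_num), contents, Nat.div_eq_of_lt hi, penaltySum,
      Finset.sum_range_zero]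
  · have hV := tableWidth_pos (h := h) (r := r)
    have hu : j % tableWidth h r < tableWidth h r := Nat.mod_lt _ hV
    have hw := eval_minWeight hσ (hσ.col hj) hu
    have hB := hσ.eval_init (a := 3) (hσ.row hj)
    have hmax : (Expr.cond (.le (.minWeight .col) (.read 3 .row)) (.lit 0)
        (.sub (.minWeight .col) (.read 3 .row))).eval σ =
        max 0 (weightTable h r I.n (j % tableWidth h r) -
          initMem I h r 3 (j / tableWidth h r)) := by
      refine eval_cond (eval_le hw hB) (fun hc => ?_) fun hc => ?_
      · rw [max_eq_left (by linarith), Expr.eval]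
      · rw [max_eq_right (by linarith), eval_sub_rat hw hB]
    rw [eval_add_rat (eval_read hj (hv j (by omega))) (eval_mul_rat hσ.rate hmax), contents,
      contents, Nat.add_mod_left, Nat.add_div_left _ hV, penaltySum, penaltySum,
      Finset.sum_range_succ]

theorem eval_objective {S : List ℕ} {x : ℕ} {u : Expr} {U : ℕ} (hσ : Filled h r S x σ)
    (hu : u.eval σ = U) (hU : U < tableWidth h r)
    (hx : 0 ≠ x := by decide) (hS : 0 ∉ S := by decide)
    (hx1 : 8 ≠ x := by decide) (hS1 : 8 ∈ S := by decide)
    (hx2 : 14 ≠ x := by decide) (hS2 : 14 ∈ S := by decide)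
    (hx3 : 18 ≠ x := by decide) (hS3 : 18 ∈ S := by decide) :
    (Expr.objective u).eval σ =
      payoffRange I * U - penaltySum h r (weightTable h r I.n U) h.length := by
  rw [Expr.objective, eval_sub_rat (eval_mul_rat (hσ.range hx hS hx1 hS1) hu)
    (hσ.eval_contents (eval_add (eval_mul (hσ.rounds hx hS) (hσ.width hx hS hx2 hS2)) hu)
    (by rw [filled]; exact table_lt (Nat.lt_succ_self _) hU) (by decide) hx3 hS3),
    contents_penalty hU]

theorem bestValue_lt {j : ℕ} (hj : j ≤ tableWidth h r) : bestValue h r j < tableWidth h r := by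
  have h1 := bestIndex_le (fun u => weightTable h r I.n u ≤ ∑ i ∈ Finset.range I.n, weightSeq I i)
    (fun u => payoffRange I * u - penaltySum h r (weightTable h r I.n u) h.length) j
  have h2 := tableWidth_pos (h := h) (r := r)
  unfold bestValue
  omega

theorem runs_findBest (hs : Small (memBound (inputSize I h)) σ)
    (hσ : Filled h r [18, 17, 16, 15, 14, 13, 12, 11, 10, 9, 8] 7 σ) :
    Runs (memBound (inputSize I h)) findBest σ
      (Filled h r [19, 18, 17, 16, 15, 14, 13, 12, 11, 10, 9, 8] 7) := by
  refine hσ.fill 1 (tableWidth h r) hs (add_comm _ _) (fun i hi => ?_) (fun _ _ => eval_one)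
    (fun σ hσ => hσ.width) fun σ j hσ hj hjM hv => ?_
  · rw [initMem_eq_zero (by norm_num), Nat.lt_one_iff.mp hi, contents, bestValue, bestIndex,
      Nat.cast_zero]
  · have hbest : (Expr.read 19 .ctr).eval σ = bestValue h r j := eval_read hj (hv j (by omega))
    have hb := bestValue_lt (h := h) (r := r) hjM.le
    rw [contents, add_comm 1 j, bestValue, bestIndex]
    refine eval_cond (p := weightTable h r I.n j ≤ ∑ i ∈ Finset.range I.n, weightSeq I i ∧
      payoffRange I * (bestValue h r j : ℕ) -
        penaltySum h r (weightTable h r I.n (bestValue h r j)) h.length ≤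
      payoffRange I * j - penaltySum h r (weightTable h r I.n j) h.length) ?_
      (fun hc => ?_) fun hc => ?_
    · rw [eval_mul_rat (eval_le (eval_minWeight hσ hj hjM) hσ.weight)
        (eval_le (eval_objective hσ hbest hb) (eval_objective hσ hj hjM)), ite_and]
      split_ifs <;> simp
    · rw [hj]
      exact congrArg _ (if_pos hc).symm
    · rw [hbest]
      exact congrArg _ (if_neg hc).symm

theorem runs_decode (hs : Small (memBound (inputSize I h)) σ)
    (hσ : Filled h r [19, 18, 17, 16, 15, 14, 13, 12, 11, 10, 9, 8] 7 σ) :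
    Runs (memBound (inputSize I h)) decode σ
      (Filled h r [5, 19, 18, 17, 16, 15, 14, 13, 12, 11, 10, 9, 8] 7) := by
  refine hσ.fill 0 I.n hs (zero_add _) (fun i hi => by omega) (fun _ _ => eval_zero)
    (fun σ hσ => hσ.items) fun σ j hσ hj hjM hv => ?_
  have hb := bestValue_lt (h := h) (r := r) le_rfl
  have hcode : Expr.code.eval σ =
      ((codeTable h r I.n (bestValue h r (tableWidth h r)) : ℕ) : ℚ) := by
    rw [Expr.code, hσ.eval_contents (eval_add (eval_mul hσ.items hσ.width)
      (hσ.eval_contents (a := 19) hσ.width (Nat.lt_succ_self _)))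
      (by rw [filled]; exact table_lt (Nat.lt_succ_self _) hb), contents_code hb]
  have hpow : (Expr.add (.read 16 .ctr) (.lit 1)).eval σ = ((2 ^ j : ℕ) : ℚ) := by
    rw [eval_add_rat (hσ.eval_contents (a := 16) hj (Nat.lt_succ_of_lt hjM)) eval_one, contents]
    push_cast
    ring
  have htwo : (Expr.lit 2).eval σ = ((2 : ℕ) : ℚ) := by rw [Expr.eval, Nat.cast_ofNat]
  have hc : contents h r 5 (0 + j) =
      ((codeTable h r I.n (bestValue h r (tableWidth h r)) / 2 ^ j % 2 : ℕ) : ℚ) := by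
    rw [zero_add, contents]
  rw [hc]
  generalize codeTable h r I.n (bestValue h r (tableWidth h r)) = c at hcode
  have e : c / 2 ^ j % 2 = c / 2 ^ j - 2 * (c / (2 * 2 ^ j)) := by
    rw [mul_comm 2 (2 ^ j), ← Nat.div_div_eq_div_mul]
    omega
  rw [e]
  refine eval_sub (eval_floor_div hcode hpow)
    (eval_mul htwo (eval_floor_div hcode (eval_mul htwo hpow))) ?_
  rw [mul_comm 2 (2 ^ j), ← Nat.div_div_eq_div_mul]
  omega

end Phases

section Algorithm

variable {I : Inst}

/-- The set computed by the program. -/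
def chosenSet (h : List (State I)) {m : ℕ} (r : Fin m → Bool) : Finset (Fin I.n) :=
  Finset.univ.filter fun i =>
    (codeTable h r I.n (bestValue h r (tableWidth h r))).testBit i = true

theorem exec_program (h : List (State I)) {m : ℕ} (r : Fin m → Bool) :
    ∃ σ k, Exec program (initMem I h r) σ k ∧
      k ≤ program.timeBound.eval (memBound (inputSize I h)) ∧
      ∀ i : Fin I.n, i ∈ chosenSet h r ↔ σ 5 i = 1 := by
  have h0 : Filled h r [] 7 (initMem I h r) := fun a _ _ =>
    ⟨fun hn => absurd hn List.not_mem_nil, fun _ => rfl⟩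
  have hrun : Runs (memBound (inputSize I h)) program (initMem I h r)
      (Filled h r [5, 19, 18, 17, 16, 15, 14, 13, 12, 11, 10, 9, 8] 7) :=
    (runs_sumWeights small_initMem h0).seq fun _ s1 h1 =>
    (runs_powersOfFour s1 h1).seq fun _ s2 h2 =>
    (runs_countBits s2 h2).seq fun _ s3 h3 =>
    (runs_sumProfits s3 h3).seq fun _ s4 h4 =>
    (runs_drawNoise s4 h4).seq fun _ s5 h5 =>
    (runs_perturbProfits s5 h5).seq fun _ s6 h6 =>
    (runs_sumValues s6 h6).seq fun _ s7 h7 =>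
    (runs_fillWeightTable s7 h7).seq fun _ s8 h8 =>
    (runs_powersOfTwo s8 h8).seq fun _ s9 h9 =>
    (runs_fillCodeTable s9 h9).seq fun _ s10 h10 =>
    (runs_sumPenalties s10 h10).seq fun _ s11 h11 =>
    (runs_findBest s11 h11).seq fun _ s12 h12 =>
    runs_decode s12 h12
  obtain ⟨σ, k, hk, hkle, -, hσ⟩ := hrun
  refine ⟨σ, k, hk, hkle, fun i => ?_⟩
  rw [(hσ 5 (by decide) (by decide)).1 (by decide) i i.2, contents]
  simp [chosenSet, Nat.testBit_eq_decide_div_mod_eq]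

theorem penaltySum_eq_totalPenalty (h : List (State I)) {m : ℕ} (r : Fin m → Bool) (w : ℚ) :
    penaltySum h r w h.length = totalPenalty h w := by
  rw [penaltySum, totalPenalty, Finset.sum_range, ← List.sum_ofFn]
  congr 1
  refine List.ext_getElem (by simp) fun s h1 h2 => ?_
  simp only [List.getElem_ofFn, List.getElem_map, initMem]
  rw [List.getElem?_eq_getElem]
  rfl

theorem totalPenalty_mono (h : List (State I)) : Monotone (totalPenalty h) := by
  intro w w' hw
  refine List.sum_le_sum fun y _ => ?_
  exact mul_le_mul_of_nonneg_left (max_le_max le_rfl (by linarith)) I.c_nonneg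

theorem perturb_roundedPayoff_eq (h : List (State I)) {m : ℕ} (r : Fin m → Bool)
    (z : Finset (Fin I.n)) :
    perturb (roundedPayoff h) (payoffRange I) (fun i => noise r I.n i (noiseBits h.length)) z =
      payoffRange I * (∑ i ∈ z.map Fin.valEmbedding, valueSeq h r i : ℕ) -
        totalPenalty h (∑ i ∈ z.map Fin.valEmbedding, weightSeq I i) := by
  have h1 : ∀ i : Fin I.n, valueSeq h r i =
      profitUnits h i + noise r I.n i (noiseBits h.length) := fun i => by simp [valueSeq]
  have h2 : ∀ i : Fin I.n, weightSeq I i = I.w i := fun i => by simp [weightSeq]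
  simp only [Finset.sum_map, Fin.valEmbedding_apply, h1, h2, perturb, roundedPayoff,
    Nat.cast_sum, Nat.cast_add, Finset.sum_add_distrib]
  ring

theorem map_chosenSet (h : List (State I)) {m : ℕ} (r : Fin m → Bool) :
    (chosenSet h r).map Fin.valEmbedding =
      codedSet I.n (codeTable h r I.n (bestValue h r (tableWidth h r))) := by
  ext i
  simp only [chosenSet, codedSet, Finset.mem_map, Finset.mem_filter, Finset.mem_univ, true_and,
    Fin.valEmbedding_apply, Finset.mem_range]
  constructor
  · rintro ⟨j, hj, rfl⟩
    exact ⟨j.2, hj⟩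
  · rintro ⟨hi, hb⟩
    exact ⟨⟨i, hi⟩, hb, rfl⟩

theorem isLeader_chosenSet (h : List (State I)) {m : ℕ} (r : Fin m → Bool) :
    IsLeader h (fun i => noise r I.n i (noiseBits h.length)) (chosenSet h r) := by
  intro z
  rw [perturb_roundedPayoff_eq, perturb_roundedPayoff_eq, map_chosenSet]
  have hinf : ∑ i ∈ Finset.range I.n, weightSeq I i < infWeight I := lt_add_one _
  have hz : z.map Fin.valEmbedding ⊆ Finset.range I.n := by
    intro i hi
    obtain ⟨j, -, rfl⟩ := Finset.mem_map.mp hi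
    exact Finset.mem_range.mpr j.2
  have := codedSet_optimal (G := payoffRange I) (pen := totalPenalty h) (v := valueSeq h r)
    (V := tableWidth h r) weightSeq_nonneg hinf (Nat.lt_succ_self _) (totalPenalty_mono h) _ hz
  simp only [← penaltySum_eq_totalPenalty h r] at this ⊢
  exact this

end Algorithm

/-- Follow the perturbed leader, with the perturbed leader computed by `program`. -/
noncomputable def followThePerturbedLeader : OnlineAlgorithm where
  coins := Polynomial.X ^ 2
  act _ h r := chosenSet h r

theorem followThePerturbedLeader_polynomialTime : followThePerturbedLeader.PolynomialTime := by
  refine ⟨program, program.timeBound.comp ((Polynomial.X + 1) * (2 * Polynomial.X ^ 2 + 1) +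
    8 * Polynomial.X + 10), fun I h r => ?_⟩
  obtain ⟨σ, k, hk, hkle, hσ⟩ := exec_program h r
  refine ⟨σ, k, hk, hkle.trans (le_of_eq ?_), hσ⟩
  rw [Polynomial.eval_comp]
  simp [memBound]

theorem followsLeader_followThePerturbedLeader : FollowsLeader followThePerturbedLeader := by
  intro I h r
  refine ⟨?_, isLeader_chosenSet h r⟩
  have h1 := card_le_inputSize I h
  have h2 := length_le_inputSize I h
  have h3 := noiseBits_le h.length
  change _ ≤ Polynomial.eval (inputSize I h) (Polynomial.X ^ 2)
  rw [Polynomial.eval_pow, Polynomial.eval_X, sq]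
  exact Nat.mul_le_mul (by omega) (by omega)

end GKP

theorem mainTheorem6 :
    ∃ A : GKP.OnlineAlgorithm, A.PolynomialTime ∧ A.VanishingRegret :=
  ⟨GKP.followThePerturbedLeader, GKP.followThePerturbedLeader_polynomialTime,
    GKP.followsLeader_followThePerturbedLeader.vanishingRegret⟩
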